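/- All modules are modules over a commutative Noetherian local ring $R$. Assume that $R$ is Gorenstein (i.e. it has finite injective dimension as a module over itself) and has the Krull–Remak–Schmidt property: whenever $\bigoplus_{i=1}^m M_i\cong\bigoplus_{j=1}^n N_j$ with all $M_i,N_j$ finitely generated, non-zero and indecomposable, one has $m=n$ and, after renumbering, $M_i\cong N_i$ for all $i$. Put $d=\dim R$. *Notation.* Let $\mathcal C$ be the set of isomorphism classes $[M]$ of finitely generated $R$-modules. Let $J(R)$ be the quotient of the free $\mathbb Z[t^{\pm1}]$-module $\bigoplus_{[M]\in\mathcal C}\mathbb Z[t^{\pm1}][M]$ by the $\mathbb Z[t^{\pm1}]$-submodule generated by - $[M]-[M']$ for every exact sequence $0\to P\to M\to M'\to 0$ of finitely generated modules with $P$ projective; - $[M]-t[M']$ for every exact sequence $0\to M'\to P\to M\to 0$ of finitely generated modules with $P$ projective; - $[M\oplus M']-[M]-[M']$ for all finitely generated modules $M,M'$. A *free cover* of $M$ is a homomorphism $\varphi:G\to M$ with $G$ free such that every homomorphism from a free module to $M$ factors through $\varphi$, and every endomorphism $f$ of $G$ with $\varphi=\varphi f$ is an automorphism. Dually, a *free envelope*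 of $M$ is a homomorphism $\varphi:M\to G$ with $G$ free such that every homomorphism from $M$ to a free module factors through $\varphi$, and every endomorphism $f$ of $G$ with $\varphi=f\varphi$ is an automorphism. Every finitely generated $M$ has a free cover and a free envelope, unique up to isomorphism. The syzygy $\Omega M$ is the kernel of a free cover of $M$, and the cosyzygy $\Omega^{-1}M$ is the cokernel of a free envelope of $M$; $\Omega^{n}$ and $\Omega^{-n}$ denote the $n$-fold iterates. A non-zero finitely generated module $M$ is *maximal Cohen–Macaulay* (MCM) if $\operatorname{depth}_R M=\dim R$. Let $\mathcal M\subseteq\mathcal C$ be the set of classes of MCM, non-free, indecomposable modules, and let $\mathcal A=\mathbb Z^{(\mathcal M)}$ be the free abelian group on $\mathcal M$. **Theorem.** 1. The rules $[M]\mapsto[\Omega^{-1}M]$ and $[M]\mapsto[\Omega M]$ define mutually inverse permutations of $\mathcal M$. Hence $\mathcal A$ is a $\mathbb Z[t^{\pm1}]$-module with $t[M]=[\Omega^{-1}M]$ and $t^{-1}[M]=[\Omega M]$. 2. The canonical homomorphism $\Phi:\mathcal A\to J(R)$, $[M]\mapsto[M]$, is an isomorphism of $\mathbb Z[t^{\pm1}]$-modules.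 3. For every finitely generated module $M$, the module $\Omega^{-(d+1)}\Omega^{d+1}M$ is isomorphic to a finite direct sum of indecomposable modules; and for every isomorphism $\Omega^{-(d+1)}\Omega^{d+1}M\cong\bigoplus_{i=1}^n M_i$ with all $M_i$ non-zero and indecomposable, every $[M_i]$ lies in $\mathcal M$ and $$\Phi^{-1}([M])=\sum_{i=1}^n[M_i].$$ -/

import Mathlib

open scoped LaurentPolynomial

universe u

namespace GrothMod

section Envelopes

variable {R : Type u} [CommRing R]

/-- A free cover of `M`: a homomorphism `φ : G → M` with `G` free, through which every
homomorphism from a free module to `M` factors, and such that every endomorphism `f` of `G`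
with `φ ∘ f = φ` is an automorphism. -/
structure IsFreeCover {G M : Type u} [AddCommGroup G] [Module R G] [AddCommGroup M] [Module R M]
    (φ : G →ₗ[R] M) : Prop where
  free : Module.Free R G
  factors : ∀ (G' : Type u) [AddCommGroup G'] [Module R G'] [Module.Free R G']
    (g : G' →ₗ[R] M), ∃ f : G' →ₗ[R] G, g = φ ∘ₗ f
  automorphism : ∀ f : G →ₗ[R] G, φ = φ ∘ₗ f → Function.Bijective f

/-- A free envelope of `M`: a homomorphism `φ : M → G` with `G` free, through which every
homomorphism from `M` to a free module factors, and such that every endomorphism `f` of `G`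
with `f ∘ φ = φ` is an automorphism. -/
structure IsFreeEnvelope {M G : Type u} [AddCommGroup M] [Module R M] [AddCommGroup G]
    [Module R G] (φ : M →ₗ[R] G) : Prop where
  free : Module.Free R G
  factors : ∀ (G' : Type u) [AddCommGroup G'] [Module R G'] [Module.Free R G']
    (g : M →ₗ[R] G'), ∃ f : G →ₗ[R] G', g = f ∘ₗ φ
  automorphism : ∀ f : G →ₗ[R] G, φ = f ∘ₗ φ → Function.Bijective f

end Envelopes

section Existence

variable {R : Type u} [CommRing R] [IsLocalRing R]

/-- A finitely generated module over a local ring has a generating family all of whose relations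
have coefficients in the maximal ideal. -/
theorem exists_minimal_generators (N : Type u) [AddCommGroup N] [Module R N]
    [Module.Finite R N] :
    ∃ (n : ℕ) (v : Fin n → N), Submodule.span R (Set.range v) = ⊤ ∧
      ∀ c : Fin n → R, ∑ j, c j • v j = 0 → ∀ j, c j ∈ IsLocalRing.maximalIdeal R := by
  classical
  have hex : ∃ (n : ℕ) (v : Fin n → N), Submodule.span R (Set.range v) = ⊤ :=
    Module.Finite.exists_fin
  obtain ⟨v, hv⟩ := Nat.find_spec hex
  refine ⟨Nat.find hex, v, hv, ?_⟩
  intro c hc i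
  by_contra hi
  have hu : IsUnit (c i) := by
    by_contra h
    exact hi ((IsLocalRing.mem_maximalIdeal _).2 h)
  have hmin : ∀ m, m < Nat.find hex → ¬ ∃ w : Fin m → N, Submodule.span R (Set.range w) = ⊤ :=
    fun m hm => Nat.find_min hex hm
  generalize Nat.find hex = n at v hv c hc i hi hu hmin
  obtain _ | k := n
  · exact i.elim0
  refine hmin k (Nat.lt_succ_self k) ⟨v ∘ i.succAbove, ?_⟩
  rw [eq_top_iff, ← hv, Submodule.span_le]
  have hmem : ∀ j, v (i.succAbove j) ∈ Submodule.span R (Set.range (v ∘ i.succAbove)) :=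
    fun j => Submodule.subset_span ⟨j, rfl⟩
  rintro _ ⟨j, rfl⟩
  by_cases hj : j = i
  · subst hj
    rw [Fin.sum_univ_succAbove _ j] at hc
    have h1 : c j • v j ∈ Submodule.span R (Set.range (v ∘ j.succAbove)) := by
      rw [eq_neg_of_add_eq_zero_left hc]
      exact Submodule.neg_mem _ (Submodule.sum_mem _ fun l _ => Submodule.smul_mem _ _ (hmem l))
    obtain ⟨w, hw⟩ := hu
    have h2 := Submodule.smul_mem _ ((w⁻¹ : Rˣ) : R) h1
    rwa [← hw, smul_smul, Units.inv_mul, one_smul] at h2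
  · obtain ⟨l, rfl⟩ := Fin.exists_succAbove_eq hj
    exact hmem l

/-- An endomorphism of a finite free module that is the identity modulo the maximal ideal is an
automorphism. -/
theorem bijective_of_sub_mem {n : ℕ} (f : (Fin n → R) →ₗ[R] (Fin n → R))
    (h : ∀ x i, (f x - x) i ∈ IsLocalRing.maximalIdeal R) : Function.Bijective f := by
  classical
  have key : IsUnit (LinearMap.toMatrix' f).det := by
    rw [← isUnit_map_iff (IsLocalRing.residue R), RingHom.map_det]
    have : (IsLocalRing.residue R).mapMatrix (LinearMap.toMatrix' f) = 1 := by
      ext i j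
      have h1 := h (Pi.single j 1) i
      rw [← IsLocalRing.residue_eq_zero_iff, Pi.sub_apply, map_sub, sub_eq_zero] at h1
      simp only [RingHom.mapMatrix_apply, Matrix.map_apply, LinearMap.toMatrix'_apply]
      convert h1 using 1
      simp [Matrix.one_apply, Pi.single_apply, apply_ite]
    rw [this, Matrix.det_one]
    exact isUnit_one
  have h2 := (Matrix.isUnit_iff_isUnit_det _).2 key
  rw [LinearMap.isUnit_toMatrix'_iff] at h2
  exact (Module.End.isUnit_iff f).1 h2

theorem exists_isFreeCover (M : Type u) [AddCommGroup M] [Module R M] [Module.Finite R M] :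
    ∃ (n : ℕ) (φ : (Fin n → R) →ₗ[R] M), IsFreeCover φ := by
  obtain ⟨n, v, hv, hrel⟩ := exists_minimal_generators (R := R) M
  refine ⟨n, Fintype.linearCombination R v, inferInstance, ?_, ?_⟩
  · intro G' _ _ _ g
    have hs : Function.Surjective (Fintype.linearCombination R v) := by
      rw [← LinearMap.range_eq_top, Fintype.range_linearCombination, hv]
    obtain ⟨f, hf⟩ := Module.projective_lifting_property _ g hs
    exact ⟨f, hf.symm⟩
  · intro f hf
    refine bijective_of_sub_mem f fun x i => hrel _ ?_ i
    have := LinearMap.congr_fun hf x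
    rw [LinearMap.comp_apply, eq_comm, ← sub_eq_zero, ← map_sub] at this
    simpa [Fintype.linearCombination_apply] using this

theorem exists_isFreeEnvelope [IsNoetherianRing R] (M : Type u) [AddCommGroup M] [Module R M]
    [Module.Finite R M] :
    ∃ (n : ℕ) (φ : M →ₗ[R] (Fin n → R)), IsFreeEnvelope φ := by
  classical
  obtain ⟨n, v, hv, hrel⟩ := exists_minimal_generators (R := R) (Module.Dual R M)
  have hgen : ∀ g : Module.Dual R M, ∃ c : Fin n → R, ∑ j, c j • v j = g := fun g =>
    Submodule.mem_span_range_iff_exists_fun R |>.1 (hv ▸ Submodule.mem_top)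
  refine ⟨n, LinearMap.pi v, inferInstance, ?_, ?_⟩
  · intro G' _ _ _ g
    let b := Module.Free.chooseBasis R G'
    obtain ⟨S, hS⟩ := Module.Finite.fg_top (R := R) (M := M)
    let s : Finset (Module.Free.ChooseBasisIndex R G') := S.biUnion fun m => (b.repr (g m)).support
    have hs : ∀ m, ∀ i ∉ s, b.repr (g m) i = 0 := by
      intro m i hi
      have hm : m ∈ Submodule.span R (S : Set M) := hS ▸ Submodule.mem_top
      have hle : Submodule.span R (S : Set M) ≤ LinearMap.ker (b.coord i ∘ₗ g) := by
        rw [Submodule.span_le]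
        intro y hy
        by_contra hne
        exact hi (Finset.mem_biUnion.2 ⟨y, hy, Finsupp.mem_support_iff.2 hne⟩)
      exact hle hm
    choose c hc using fun i => hgen (b.coord i ∘ₗ g)
    refine ⟨Fintype.linearCombination R (fun j => ∑ i ∈ s, c i j • b i), ?_⟩
    ext m
    rw [LinearMap.comp_apply, Fintype.linearCombination_apply]
    have h1 : g m = ∑ i ∈ s, b.repr (g m) i • b i := by
      conv_lhs => rw [← b.linearCombination_repr (g m), Finsupp.linearCombination_apply]
      refine Finsupp.sum_of_support_subset _ ?_ _ (by simp)
      intro i hi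
      by_contra hne
      exact Finsupp.mem_support_iff.1 hi (hs m i hne)
    rw [h1]
    simp_rw [Finset.smul_sum]
    rw [Finset.sum_comm]
    refine Finset.sum_congr rfl fun i _ => ?_
    have h2 := LinearMap.congr_fun (hc i) m
    rw [LinearMap.comp_apply, Module.Basis.coord_apply] at h2
    rw [← h2, LinearMap.sum_apply, Finset.sum_smul]
    refine Finset.sum_congr rfl fun j _ => ?_
    rw [smul_smul, LinearMap.smul_apply, LinearMap.pi_apply, smul_eq_mul, mul_comm]
  · intro f hf
    have hsum : ∀ y : Fin n → R, f y = ∑ j, y j • f (Pi.single j 1) := by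
      intro y
      conv_lhs => rw [pi_eq_sum_univ' y, map_sum]
      simp_rw [map_smul]
    have hmat : ∀ i j : Fin n, (f (Pi.single j 1) - Pi.single j 1 : Fin n → R) i ∈ IsLocalRing.maximalIdeal R := by
      intro i j
      refine hrel (fun j => (f (Pi.single j 1) - Pi.single j 1 : Fin n → R) i) ?_ j
      ext m
      have h1 := congr_fun (LinearMap.congr_fun hf m) i
      rw [LinearMap.comp_apply, hsum] at h1
      simp only [LinearMap.pi_apply, Finset.sum_apply, Pi.smul_apply, smul_eq_mul] at h1
      simp only [LinearMap.sum_apply, LinearMap.smul_apply, smul_eq_mul, Pi.sub_apply, sub_mul,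
        Finset.sum_sub_distrib, LinearMap.zero_apply]
      rw [sub_eq_zero]
      simp_rw [mul_comm _ (v _ m)]
      rw [← h1]
      simp [Pi.single_apply]
    refine bijective_of_sub_mem f fun x i => ?_
    have h2 : f x - x = ∑ j, x j • (f (Pi.single j 1) - Pi.single j 1 : Fin n → R) := by
      simp_rw [smul_sub, Finset.sum_sub_distrib]
      rw [← hsum, ← pi_eq_sum_univ' x]
    rw [h2, Finset.sum_apply]
    exact Ideal.sum_mem _ fun j _ => Ideal.mul_mem_left _ _ (hmat i j)

end Existence

noncomputable section

section Syzygies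

variable {R : Type u} [CommRing R] [IsLocalRing R] [IsNoetherianRing R]

/-- The syzygy `Ω M`: the kernel of a free cover of `M`. -/
def syzygy (M : FGModuleCat.{u} R) : FGModuleCat.{u} R :=
  FGModuleCat.of R (LinearMap.ker (exists_isFreeCover (R := R) M).choose_spec.choose)

/-- The cosyzygy `Ω⁻¹ M`: the cokernel of a free envelope of `M`. -/
def cosyzygy (M : FGModuleCat.{u} R) : FGModuleCat.{u} R :=
  FGModuleCat.of R ((Fin (exists_isFreeEnvelope (R := R) M).choose → R) ⧸
    LinearMap.range (exists_isFreeEnvelope (R := R) M).choose_spec.choose)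

end Syzygies

section IsoClasses

variable (R : Type u) [CommRing R]

/-- Isomorphism of finitely generated `R`-modules. -/
def isoSetoid : Setoid (FGModuleCat.{u} R) where
  r M N := Nonempty (M ≃ₗ[R] N)
  iseqv := ⟨fun _ => ⟨LinearEquiv.refl R _⟩, fun ⟨e⟩ => ⟨e.symm⟩,
    fun ⟨e⟩ ⟨f⟩ => ⟨e.trans f⟩⟩

/-- The isomorphism classes of finitely generated `R`-modules. -/
def IsoClass : Type (u + 1) := Quotient (isoSetoid R)

variable {R}

/-- The isomorphism class `[M]`. -/
def isoClass (M : FGModuleCat.{u} R) : IsoClass R := Quotient.mk (isoSetoid R) M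

variable (R)

/-- The free `ℤ[t, t⁻¹]`-module on the isomorphism classes. -/
abbrev FreeOnClasses : Type (u + 1) := IsoClass R →₀ ℤ[T;T⁻¹]

variable {R}

/-- The basis element `[M]`. -/
def gen (M : FGModuleCat.{u} R) : FreeOnClasses R := Finsupp.single (isoClass M) 1

variable (R)

/-- `[M] - [M']` for every exact `0 → P → M → M' → 0` with `P` projective. -/
def relOne : Set (FreeOnClasses R) :=
  {z | ∃ (P M M' : FGModuleCat.{u} R) (f : P →ₗ[R] M) (g : M →ₗ[R] M'),
    Module.Projective R P ∧ Function.Injective f ∧ Function.Exact f g ∧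
      Function.Surjective g ∧ z = gen M - gen M'}

/-- `[M] - t [M']` for every exact `0 → M' → P → M → 0` with `P` projective. -/
def relTwo : Set (FreeOnClasses R) :=
  {z | ∃ (M' P M : FGModuleCat.{u} R) (f : M' →ₗ[R] P) (g : P →ₗ[R] M),
    Module.Projective R P ∧ Function.Injective f ∧ Function.Exact f g ∧
      Function.Surjective g ∧ z = gen M - (LaurentPolynomial.T 1 : ℤ[T;T⁻¹]) • gen M'}

/-- `[M ⊕ M'] - [M] - [M']`. -/
def relThree : Set (FreeOnClasses R) :=
  {z | ∃ M M' : FGModuleCat.{u} R, z = gen (FGModuleCat.of R (M × M')) - gen M - gen M'}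

/-- The submodule of relations. -/
def relations : Submodule ℤ[T;T⁻¹] (FreeOnClasses R) :=
  Submodule.span ℤ[T;T⁻¹] (relOne R ∪ relTwo R ∪ relThree R)

/-- The module `J(R)`. -/
abbrev J : Type (u + 1) := FreeOnClasses R ⧸ relations R

variable {R}

/-- The class in `J(R)` of an isomorphism class of modules. -/
def classJ (x : IsoClass R) : J R := (relations R).mkQ (Finsupp.single x 1)

end IsoClasses

section MCM

variable (R : Type u) [CommRing R]

/-- A ring is Gorenstein here if it has finite injective dimension as a module over itself. -/
def IsGorenstein : Prop :=
  ∃ n : ℕ, CategoryTheory.HasInjectiveDimensionLE (ModuleCat.of R R) n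

/-- A module is indecomposable if it is non-zero and is not the direct sum of two non-zero
submodules. -/
def IsIndecomposable (M : Type u) [AddCommGroup M] [Module R M] : Prop :=
  Nontrivial M ∧ ∀ p q : Submodule R M, IsCompl p q → p = ⊥ ∨ q = ⊥

/-- The Krull–Remak–Schmidt property: decompositions of finitely generated modules into finite
direct sums of indecomposable modules are unique up to isomorphism and order. -/
def KrullRemakSchmidt : Prop :=
  ∀ (m n : ℕ) (M : Fin m → FGModuleCat.{u} R) (N : Fin n → FGModuleCat.{u} R),
    (∀ i, IsIndecomposable R (M i)) → (∀ j, IsIndecomposable R (N j)) →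
    Nonempty ((∀ i, M i) ≃ₗ[R] (∀ j, N j)) →
    ∃ e : Fin m ≃ Fin n, ∀ i, Nonempty (M i ≃ₗ[R] N (e i))

variable [IsLocalRing R]

/-- The depth of a module over a local ring: the supremum of the lengths of the `M`-regular
sequences in the maximal ideal. -/
def depth (M : Type u) [AddCommGroup M] [Module R M] : ℕ∞ :=
  ⨆ (rs : List R) (_ : ∀ r ∈ rs, r ∈ IsLocalRing.maximalIdeal R)
    (_ : RingTheory.Sequence.IsRegular M rs), (rs.length : ℕ∞)

/-- Maximal Cohen–Macaulay modules. -/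
def IsMCM (M : Type u) [AddCommGroup M] [Module R M] : Prop :=
  Nontrivial M ∧ (depth R M : WithBot ℕ∞) = ringKrullDim R

/-- The set of isomorphism classes of indecomposable, non-free MCM modules. -/
def mcmClasses : Set (IsoClass R) :=
  isoClass '' {M | IsMCM R M ∧ ¬ Module.Free R M ∧ IsIndecomposable R M}

/-- The canonical map, as a homomorphism of abelian groups, from the free abelian group on the
classes of indecomposable, non-free MCM modules to `J(R)`. -/
def canonicalMap : (mcmClasses R →₀ ℤ) →ₗ[ℤ] J R :=
  Finsupp.linearCombination ℤ fun x : mcmClasses R => classJ x.1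

end MCM

section PermModule

/-- The free abelian group `ℤ^(X)` on a set `X` with a permutation `σ`, i.e. an action of the
infinite cyclic group `⟨t⟩` in which `t` acts as `σ`; it is regarded as a `ℤ[t, t⁻¹]`-module. -/
def PermModule {X : Type*} (_σ : Equiv.Perm X) := X →₀ ℤ

variable {X : Type*} (σ : Equiv.Perm X)

instance : AddCommGroup (PermModule σ) := inferInstanceAs (AddCommGroup (X →₀ ℤ))

/-- The identity map from `ℤ^(X)`. -/
def toPermModule : (X →₀ ℤ) ≃+ PermModule σ := AddEquiv.refl _

/-- The action of the cyclic group: `t ^ n` sends the basis element `x` to `σ ^ n x`. -/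
def permAction : Multiplicative ℤ →* Module.End ℤ (X →₀ ℤ) where
  toFun n := Finsupp.lmapDomain ℤ ℤ ⇑(σ ^ n.toAdd)
  map_one' := by ext; simp
  map_mul' a b := by ext; simp [zpow_add]

instance : Module ℤ[T;T⁻¹] (PermModule σ) :=
  Module.compHom (X →₀ ℤ)
    (AddMonoidAlgebra.lift ℤ (Module.End ℤ (X →₀ ℤ)) ℤ (permAction σ)).toRingHom

theorem T_smul_single (n : ℤ) (x : X) (k : ℤ) :
    (LaurentPolynomial.T n : ℤ[T;T⁻¹]) • toPermModule σ (Finsupp.single x k) =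
      toPermModule σ (Finsupp.single ((σ ^ n) x) k) := by
  change AddMonoidAlgebra.lift ℤ (Module.End ℤ (X →₀ ℤ)) ℤ (permAction σ)
    (LaurentPolynomial.T n) (Finsupp.single x k) = Finsupp.single ((σ ^ n) x) k
  rw [LaurentPolynomial.T, AddMonoidAlgebra.lift_single]
  simp [permAction]

end PermModule

end

end GrothMod

open GrothMod

/-!
The proof identifies the inverse of the canonical map as `[M] ↦ t^{d+1} [Ω^{d+1} M]`.

*The ring.* The support of `Ext^i(R/p, R)` propagates along coverings of primes with a shift of
the degree by one (`mem_support_extR_succ`), so `Ext^d(k, R) ≠ 0` for the residue field `k`, and the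
injective dimension of `R` is at least `d`. If a maximal `R`-regular sequence has length `s`, then
`k` embeds in the quotient of `R` by it, and this, with Nakayama's lemma for the other primes, lowers
any finite bound on the degrees of the non-zero `Ext^i(-, R)` to `s` (`ExtVanishesAbove.pred`).
Hence `d ≤ s`; as `s ≤ d` always, `R` has injective dimension at most `d` and depth `d`.

*The modules.* Consequently the maximal Cohen–Macaulay modules are the non-zero `M` with
`Ext^i(M, R) = 0` for all `i > 0` (`isMCM_iff_dualAcyclic`). Dualizing resolutions twice shows that
these `M` embed in their free envelopes, so `M` is a syzygy of `Ω⁻¹ M`, and `Ω⁻¹ M` is of the same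
kind. Free covers and free envelopes are minimal: the kernel of a cover lies in `mF`, and the
cokernel of an envelope has no free summand. Minimal syzygies are unique
(`IsMinimalSyzygy.nonempty_equiv`), and a module without free summand and with
`Ext^i(M, R) = 0` for `i > 0` is determined by its minimal syzygy
(`ReducedAcyclic.nonempty_equiv`). So `Ω` and `Ω⁻¹` are mutually inverse on such modules; they
preserve direct sums, hence indecomposability, and give the permutation `cosyzygyPerm`.

*The inverse.* The module `Ω^{d+1} M` has no free summand and vanishing `Ext^i(-, R)` for `i > 0`
(`reducedAcyclic_syzygy_iterate`), so by the Krull–Remak–Schmidt property it has a class in the free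
group on indecomposable classes. The element `t^{d+1} [Ω^{d+1} M]` respects the relations of
`J(R)`, by Schanuel's lemma (`stableClass_of_exact`, `stableClass_eq_of_exact`). In `J(R)` one has
`[M] = t^{d+1} [Ω^{d+1} M]`, and for `M` without free summand and with vanishing
`Ext^i(M, R)` the factor `t^{d+1}` undoes the syzygies; so the two maps are mutually inverse. Finally
`t^{d+1} [Ω^{d+1} M] = [Ω^{-(d+1)} Ω^{d+1} M]`.
-/

namespace GrothMod

open CategoryTheory CategoryTheory.Abelian

/-! ### Vanishing of `Ext^i(M, R)` -/

section ExtVanishing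

variable {R : Type u} [CommRing R]

/-- The condition `Ext^i(M, R) = 0`. -/
def ExtVanishes (R : Type u) [CommRing R] (M : Type u) [AddCommGroup M] [Module R M]
    (i : ℕ) : Prop :=
  Subsingleton (Ext (ModuleCat.of R M) (ModuleCat.of R R) i)

variable {A B C : Type u} [AddCommGroup A] [Module R A] [AddCommGroup B] [Module R B]
  [AddCommGroup C] [Module R C]

theorem shortExact_of_exact {f : A →ₗ[R] B} {g : B →ₗ[R] C} (hf : Function.Injective f)
    (hfg : Function.Exact f g) (hg : Function.Surjective g) :
    (ModuleCat.shortComplexOfCompEqZero f g hfg.linearMap_comp_eq_zero).ShortExact :=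
  ModuleCat.shortComplex_shortExact _ hfg hf hg

theorem ExtVanishes.of_retract {i : ℕ} (hB : ExtVanishes R B i) (s : A →ₗ[R] B) (r : B →ₗ[R] A)
    (hrs : r ∘ₗ s = LinearMap.id) : ExtVanishes R A i := by
  refine subsingleton_of_forall_eq 0 fun e => ?_
  have h : ModuleCat.ofHom s ≫ ModuleCat.ofHom r = 𝟙 (ModuleCat.of R A) := by
    rw [← ModuleCat.ofHom_comp, hrs]; rfl
  have h0 : (Ext.mk₀ (ModuleCat.ofHom r)).comp e (zero_add i) = 0 :=
    @Subsingleton.elim _ hB _ _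
  rw [← Ext.mk₀_id_comp e, ← h, ← Ext.mk₀_comp_mk₀_assoc, h0, Ext.comp_zero]

theorem ExtVanishes.congr {i : ℕ} (hB : ExtVanishes R B i) (e : A ≃ₗ[R] B) :
    ExtVanishes R A i :=
  hB.of_retract (e : A →ₗ[R] B) (e.symm : B →ₗ[R] A) (by ext; simp)

theorem ExtVanishes.of_projective [Module.Projective R A] (i : ℕ) :
    ExtVanishes R A (i + 1) :=
  ⟨fun x y => (Ext.eq_zero_of_projective x).trans (Ext.eq_zero_of_projective y).symm⟩

theorem ExtVanishes.middle {f : A →ₗ[R] B} {g : B →ₗ[R] C} (hf : Function.Injective f)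
    (hfg : Function.Exact f g) (hg : Function.Surjective g) {i : ℕ}
    (hA : ExtVanishes R A i) (hC : ExtVanishes R C i) : ExtVanishes R B i := by
  refine subsingleton_of_forall_eq 0 fun e => ?_
  obtain ⟨e', rfl⟩ := Ext.contravariant_sequence_exact₂ (shortExact_of_exact hf hfg hg)
    (ModuleCat.of R R) e (@Subsingleton.elim _ hA _ _)
  rw [@Subsingleton.elim _ hC e' 0, Ext.comp_zero]

theorem ExtVanishes.left {f : A →ₗ[R] B} {g : B →ₗ[R] C} (hf : Function.Injective f)
    (hfg : Function.Exact f g) (hg : Function.Surjective g) {i : ℕ}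
    (hB : ExtVanishes R B i) (hC : ExtVanishes R C (i + 1)) : ExtVanishes R A i := by
  refine subsingleton_of_forall_eq 0 fun e => ?_
  obtain ⟨e', rfl⟩ := Ext.contravariant_sequence_exact₁ (shortExact_of_exact hf hfg hg)
    (ModuleCat.of R R) e (add_comm 1 i) (@Subsingleton.elim _ hC _ _)
  rw [@Subsingleton.elim _ hB e' 0, Ext.comp_zero]

theorem ExtVanishes.right {f : A →ₗ[R] B} {g : B →ₗ[R] C} (hf : Function.Injective f)
    (hfg : Function.Exact f g) (hg : Function.Surjective g) {i : ℕ}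
    (hA : ExtVanishes R A i) (hB : ExtVanishes R B (i + 1)) : ExtVanishes R C (i + 1) := by
  refine subsingleton_of_forall_eq 0 fun e => ?_
  obtain ⟨e', rfl⟩ := Ext.contravariant_sequence_exact₃ (shortExact_of_exact hf hfg hg)
    (ModuleCat.of R R) e (@Subsingleton.elim _ hB _ _) (add_comm 1 i)
  rw [@Subsingleton.elim _ hA e' 0, Ext.comp_zero]

/-- If `Ext^1(C, R) = 0`, functionals extend along an injection with cokernel `C`. -/
theorem ExtVanishes.exists_extension {f : A →ₗ[R] B} {g : B →ₗ[R] C}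
    (hf : Function.Injective f) (hfg : Function.Exact f g) (hg : Function.Surjective g)
    (hC : ExtVanishes R C 1) (φ : A →ₗ[R] R) : ∃ ψ : B →ₗ[R] R, ψ ∘ₗ f = φ := by
  obtain ⟨e, he⟩ := Ext.contravariant_sequence_exact₁ (shortExact_of_exact hf hfg hg)
    (ModuleCat.of R R) (Ext.mk₀ (ModuleCat.ofHom φ)) (add_comm 1 0) (@Subsingleton.elim _ hC _ _)
  obtain ⟨ψ, rfl⟩ := (Ext.mk₀_bijective _ _).surjective e
  rw [Ext.mk₀_comp_mk₀] at he
  have := (Ext.mk₀_bijective _ _).injective he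
  exact ⟨ψ.hom, congrArg ModuleCat.Hom.hom this⟩

/-- If the middle term of a short exact sequence is projective and functionals extend to it, then
`Ext^1` of the cokernel vanishes. -/
theorem ExtVanishes.one_of_extension [Module.Projective R B] {f : A →ₗ[R] B} {g : B →ₗ[R] C}
    (hf : Function.Injective f) (hfg : Function.Exact f g) (hg : Function.Surjective g)
    (h : ∀ φ : A →ₗ[R] R, ∃ ψ : B →ₗ[R] R, ψ ∘ₗ f = φ) : ExtVanishes R C 1 := by
  refine subsingleton_of_forall_eq 0 fun e => ?_
  have S := shortExact_of_exact hf hfg hg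
  obtain ⟨e', rfl⟩ := Ext.contravariant_sequence_exact₃ S
    (ModuleCat.of R R) e (@Subsingleton.elim _ (ExtVanishes.of_projective (R := R) (A := B) 0) _ _)
    (add_comm 1 0)
  obtain ⟨φ, rfl⟩ := (Ext.mk₀_bijective _ _).surjective e'
  obtain ⟨ψ, hψ⟩ := h φ.hom
  have h2 : φ = ModuleCat.ofHom f ≫ ModuleCat.ofHom ψ := by
    ext x; exact (LinearMap.congr_fun hψ x).symm
  rw [h2, ← Ext.mk₀_comp_mk₀]
  exact S.extClass_comp_assoc _

open scoped Pointwise in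
theorem exact_lsmul_mkQ (x : R) :
    Function.Exact (LinearMap.lsmul R A x) (x • (⊤ : Submodule R A)).mkQ :=
  LinearMap.exact_lsmul_mkQ_smul_top A x

/-- Multiplication by `x` on the first variable is multiplication by `x` on `Ext`. -/
theorem mk₀_lsmul_comp (x : R) {i : ℕ} (e : Ext (ModuleCat.of R A) (ModuleCat.of R R) i) :
    (Ext.mk₀ (ModuleCat.ofHom (LinearMap.lsmul R A x))).comp e (zero_add i) = x • e := by
  have : ModuleCat.ofHom (LinearMap.lsmul R A x) = x • 𝟙 (ModuleCat.of R A) := rfl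
  rw [this, Ext.mk₀_smul, Ext.smul_comp, Ext.mk₀_id_comp]

/-- If `x` is regular on `A` and `Ext^{i+1}(A/xA, R)` is killed by `r`, then
`r Ext^i(A, R) ⊆ x Ext^i(A, R)`. -/
theorem exists_smul_eq_smul_of_isSMulRegular {x r : R} (hx : IsSMulRegular A x) {i : ℕ}
    (hr : ∀ e : Ext (ModuleCat.of R (QuotSMulTop x A)) (ModuleCat.of R R) (i + 1), r • e = 0)
    (e : Ext (ModuleCat.of R A) (ModuleCat.of R R) i) :
    ∃ e' : Ext (ModuleCat.of R A) (ModuleCat.of R R) i, r • e = x • e' := by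
  have S := shortExact_of_exact (f := LinearMap.lsmul R A x) hx (exact_lsmul_mkQ x)
    (Submodule.mkQ_surjective _)
  obtain ⟨e', he'⟩ := Ext.contravariant_sequence_exact₁ S (ModuleCat.of R R) (r • e)
    (add_comm 1 i) (by rw [Ext.comp_smul]; exact hr _)
  exact ⟨e', he'.symm.trans (mk₀_lsmul_comp x e')⟩

/-- Nakayama: if `x` lies in the maximal ideal and is regular on `A`, vanishing of
`Ext^{i+1}(A/xA, R)` gives vanishing of `Ext^i(A, R)`. -/
theorem ExtVanishes.of_quotSMulTop [IsLocalRing R] [IsNoetherianRing R] [Module.Finite R A]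
    {x : R} (hxm : x ∈ IsLocalRing.maximalIdeal R) (hx : IsSMulRegular A x) {i : ℕ}
    (h : ExtVanishes R (QuotSMulTop x A) (i + 1)) : ExtVanishes R A i := by
  have key : (⊤ : Submodule R (Ext (ModuleCat.of R A) (ModuleCat.of R R) i)) = ⊥ := by
    have : Module.Finite R (ModuleCat.of R A) := ‹Module.Finite R A›
    have : Module.Finite R (ModuleCat.of R R) := inferInstanceAs (Module.Finite R R)
    refine Submodule.eq_bot_of_le_smul_of_le_jacobson_bot (IsLocalRing.maximalIdeal R) _
      Module.Finite.fg_top ?_ (IsLocalRing.maximalIdeal_le_jacobson _)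
    intro e _
    obtain ⟨e', he'⟩ := exists_smul_eq_smul_of_isSMulRegular (r := 1) hx
      (fun e => @Subsingleton.elim _ h _ _) e
    rw [one_smul] at he'
    rw [he']
    exact Submodule.smul_mem_smul hxm Submodule.mem_top
  exact (Submodule.subsingleton_iff R).1 (subsingleton_of_bot_eq_top key.symm)

end ExtVanishing

end GrothMod

namespace GrothMod

open CategoryTheory CategoryTheory.Abelian

/-! ### The injective dimension, the Krull dimension and the depth of a Gorenstein ring -/

section Support

variable {R : Type u} [CommRing R] [IsNoetherianRing R]

/-- The module `Ext^i(M, R)`. -/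
abbrev ExtR (R : Type u) [CommRing R] (M : Type u) [AddCommGroup M] [Module R M] (i : ℕ) :
    Type u :=
  Ext (ModuleCat.of R M) (ModuleCat.of R R) i

instance finite_extR (M : Type u) [AddCommGroup M] [Module R M] [Module.Finite R M] (i : ℕ) :
    Module.Finite R (ExtR R M i) :=
  have : Module.Finite R (ModuleCat.of R M) := ‹Module.Finite R M›
  have : Module.Finite R (ModuleCat.of R R) := inferInstanceAs (Module.Finite R R)
  inferInstance

variable {A B C : Type u} [AddCommGroup A] [Module R A] [AddCommGroup B] [Module R B]
  [AddCommGroup C] [Module R C]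

omit [IsNoetherianRing R] in
theorem notMem_support_extR_middle {f : A →ₗ[R] B} {g : B →ₗ[R] C} (hf : Function.Injective f)
    (hfg : Function.Exact f g) (hg : Function.Surjective g) {i : ℕ} {q : PrimeSpectrum R}
    (hA : q ∉ Module.support R (ExtR R A i)) (hC : q ∉ Module.support R (ExtR R C i)) :
    q ∉ Module.support R (ExtR R B i) := by
  rw [Module.notMem_support_iff'] at hA hC ⊢
  intro e
  obtain ⟨r, hr, hre⟩ := hA ((Ext.mk₀ (ModuleCat.ofHom f)).comp e (zero_add i))
  rw [← Ext.comp_smul] at hre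
  obtain ⟨e', he'⟩ := Ext.contravariant_sequence_exact₂ (shortExact_of_exact hf hfg hg)
    (ModuleCat.of R R) (r • e) hre
  obtain ⟨s, hs, hse⟩ := hC e'
  refine ⟨s * r, fun h => (q.2.mem_or_mem h).elim hs hr, ?_⟩
  rw [mul_smul, ← he', ← Ext.comp_smul, hse, Ext.comp_zero]

omit [IsNoetherianRing R] in
theorem notMem_support_extR_of_notMem_support {i : ℕ} {q : PrimeSpectrum R} [Module.Finite R A]
    (hq : q ∉ Module.support R A) : q ∉ Module.support R (ExtR R A i) := by
  rw [Module.mem_support_iff_of_finite, SetLike.not_le_iff_exists] at hq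
  obtain ⟨r, hr, hrq⟩ := hq
  rw [Module.notMem_support_iff']
  refine fun e => ⟨r, hrq, ?_⟩
  have h0 : LinearMap.lsmul R A r = 0 := by
    ext a; exact Module.mem_annihilator.1 hr a
  rw [← mk₀_lsmul_comp, h0]
  exact (congrArg (fun z => Ext.comp z e (zero_add i)) (Ext.mk₀_zero _ _)).trans
    (Ext.zero_comp _ _ e _ _)

omit [IsNoetherianRing R] in
theorem mem_support_extR_congr {i : ℕ} {q : PrimeSpectrum R} (e : A ≃ₗ[R] B)
    (h : q ∈ Module.support R (ExtR R A i)) : q ∈ Module.support R (ExtR R B i) := by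
  rw [Module.mem_support_iff'] at h ⊢
  obtain ⟨x, hx⟩ := h
  refine ⟨(Ext.mk₀ (ModuleCat.ofHom (e.symm : B →ₗ[R] A))).comp x (zero_add i),
    fun r hr h0 => hx r hr ?_⟩
  have h1 : ModuleCat.ofHom (e : A →ₗ[R] B) ≫ ModuleCat.ofHom (e.symm : B →ₗ[R] A) = 𝟙 _ := by
    ext; simp
  rw [← Ext.comp_smul] at h0
  rw [← Ext.mk₀_id_comp (r • x), ← h1, ← Ext.mk₀_comp_mk₀_assoc, h0, Ext.comp_zero]

/-- If `q` is the only prime below `q` in the support of `N` and `q` is not in the support of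
`Ext^i(R/q, R)`, then it is not in the support of `Ext^i(N, R)`. -/
theorem notMem_support_extR_of_quotient {q : PrimeSpectrum R} {i : ℕ}
    (hq : q ∉ Module.support R (ExtR R (R ⧸ q.asIdeal) i))
    (N : Type u) [AddCommGroup N] [Module R N] [hN : Module.Finite R N]
    (h : ∀ p ∈ Module.support R N, p ≤ q → p = q) :
    q ∉ Module.support R (ExtR R N i) := by
  induction hN using IsNoetherianRing.induction_on_isQuotientEquivQuotientPrime R with
  | subsingleton N =>
    apply notMem_support_extR_of_notMem_support
    rw [Module.support_eq_empty]; exact Set.notMem_empty _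
  | quotient N p e =>
    by_cases hpq : p ≤ q
    · obtain rfl : p = q := h p (by
        rw [e.support_eq, Module.mem_support_iff_of_finite, Ideal.annihilator_quotient]) hpq
      exact fun h' => hq (mem_support_extR_congr e h')
    · apply notMem_support_extR_of_notMem_support
      rw [e.support_eq, Module.mem_support_iff_of_finite, Ideal.annihilator_quotient]
      exact hpq
  | exact N₁ N₂ N₃ f g hf hg hfg h₁ h₃ =>
    rw [Module.support_of_exact hfg hf hg] at h
    exact notMem_support_extR_middle hf hfg hg (h₁ fun p hp => h p (Or.inl hp))
      (h₃ fun p hp => h p (Or.inr hp))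

omit [IsNoetherianRing R] in
theorem isSMulRegular_quotient_of_notMem (p : PrimeSpectrum R) {x : R} (hx : x ∉ p.asIdeal) :
    IsSMulRegular (R ⧸ p.asIdeal) x := by
  rw [isSMulRegular_iff_right_eq_zero_of_smul]
  intro y hy
  obtain ⟨y, rfl⟩ := Ideal.Quotient.mk_surjective y
  rw [← Ideal.Quotient.mk_eq_mk, ← Submodule.Quotient.mk_smul, Submodule.Quotient.mk_eq_zero,
    smul_eq_mul] at hy
  rw [Ideal.Quotient.eq_zero_iff_mem]
  exact (p.2.mem_or_mem hy).resolve_left hx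

/-- The support of `Ext^i(R/p, R)` propagates upwards along a covering `p < q` of primes, the
degree going up by one. -/
theorem mem_support_extR_succ {p q : PrimeSpectrum R} (hpq : p < q)
    (hcov : ∀ p', p < p' → p' ≤ q → p' = q) {i : ℕ}
    (hp : p ∈ Module.support R (ExtR R (R ⧸ p.asIdeal) i)) :
    q ∈ Module.support R (ExtR R (R ⧸ q.asIdeal) (i + 1)) := by
  by_contra hq
  obtain ⟨x, hxq, hxp⟩ := SetLike.exists_of_lt (show p.asIdeal < q.asIdeal from hpq)
  have h1 : q ∉ Module.support R (ExtR R (QuotSMulTop x (R ⧸ p.asIdeal)) (i + 1)) := by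
    refine notMem_support_extR_of_quotient hq _ fun p' hp' hle => hcov p' ?_ hle
    rw [Module.support_quotSMulTop] at hp'
    obtain ⟨hp1, hp2⟩ := hp'
    rw [Module.mem_support_iff_of_finite, Ideal.annihilator_quotient] at hp1
    refine lt_of_le_of_ne hp1 ?_
    rintro rfl
    exact hxp (hp2 rfl)
  rw [Module.mem_support_iff_of_finite, SetLike.not_le_iff_exists] at h1
  obtain ⟨r, hr, hrq⟩ := h1
  have hreg := isSMulRegular_quotient_of_notMem p hxp
  -- `r` kills `E/qE` for `E = Ext^i(R/p, R)`, so `q` is not in the support of `E`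
  have h2 : q ∉ Module.support R (ExtR R (R ⧸ p.asIdeal) i) := by
    intro hmem
    have h3 : q ∈ Module.support R (ExtR R (R ⧸ p.asIdeal) i ⧸
        (q.asIdeal • ⊤ : Submodule R (ExtR R (R ⧸ p.asIdeal) i))) := by
      rw [Module.support_quotient]
      exact ⟨hmem, le_refl q.asIdeal⟩
    rw [Module.mem_support_iff_of_finite] at h3
    refine hrq (h3 (Module.mem_annihilator.2 fun e => ?_))
    obtain ⟨e, rfl⟩ := Submodule.mkQ_surjective _ e
    obtain ⟨e', he'⟩ := exists_smul_eq_smul_of_isSMulRegular hreg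
      (fun e => Module.mem_annihilator.1 hr e) e
    rw [← map_smul, he', Submodule.mkQ_apply, Submodule.Quotient.mk_eq_zero]
    exact Submodule.smul_mem_smul hxq Submodule.mem_top
  exact h2 (Module.mem_support_mono hpq.le hp)

theorem mem_support_extR_of_isMin {p : PrimeSpectrum R} (hp : IsMin p) :
    p ∈ Module.support R (ExtR R (R ⧸ p.asIdeal) 0) := by
  have hass : p.asIdeal ∈ associatedPrimes R R := by
    apply Module.associatedPrimes.minimalPrimes_annihilator_subset_associatedPrimes
    have : Module.annihilator R R = ⊥ := by
      rw [Module.annihilator_eq_bot]; infer_instance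
    rw [this]
    exact PrimeSpectrum.isMin_iff.1 hp
  rw [AssociatedPrimes.mem_iff, isAssociatedPrime_iff] at hass
  obtain ⟨-, a, ha⟩ := hass
  have hmem : ∀ r, r ∈ p.asIdeal ↔ r * a = 0 := by
    intro r; rw [ha, Submodule.mem_colon_singleton]; simp
  let φ : (R ⧸ p.asIdeal) →ₗ[R] R := Submodule.liftQ p.asIdeal (LinearMap.toSpanSingleton R R a)
    (fun r hr => by simpa using (hmem r).1 hr)
  rw [Module.mem_support_iff']
  refine ⟨Ext.mk₀ (ModuleCat.ofHom φ), fun r hr h0 => hr ?_⟩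
  rw [← Ext.mk₀_smul, Ext.mk₀_eq_zero_iff] at h0
  have h1 : r • φ (Submodule.Quotient.mk 1) = 0 :=
    congrArg (fun z : ModuleCat.of R (R ⧸ p.asIdeal) ⟶ ModuleCat.of R R =>
      z.hom (Submodule.Quotient.mk 1)) h0
  have h2 : φ (Submodule.Quotient.mk 1) = a :=
    (Submodule.liftQ_apply _ _ _).trans (one_smul R a)
  rw [h2] at h1
  exact (hmem r).2 h1

/-- A prime `q` of height `t` lies in the support of `Ext^t(R/q, R)`. -/
theorem mem_support_extR_of_height (t : ℕ) (q : PrimeSpectrum R) (hq : Order.height q = t) :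
    q ∈ Module.support R (ExtR R (R ⧸ q.asIdeal) t) := by
  induction t generalizing q with
  | zero => exact mem_support_extR_of_isMin (Order.height_eq_zero.1 hq)
  | succ t ih =>
    obtain ⟨-, ⟨p, hpq, hp⟩, hall⟩ := Order.height_eq_coe_add_one_iff.1 hq
    refine mem_support_extR_succ hpq (fun p' hpp' hle => ?_) (ih p hp)
    by_contra hne
    have h1 := hall p' (lt_of_le_of_ne hle hne)
    have h2 := Order.height_add_one_le hpp'
    rw [hp] at h2
    have := h2.trans h1
    norm_cast at this
    omega

end Support

section Gorenstein

variable {R : Type u} [CommRing R] [IsLocalRing R] [IsNoetherianRing R]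

/-- `Ext^i(N, R) = 0` for all finitely generated `N` and all `i > n`. -/
def ExtVanishesAbove (R : Type u) [CommRing R] (n : ℕ) : Prop :=
  ∀ (N : Type u) [AddCommGroup N] [Module R N] [Module.Finite R N] (i : ℕ), n < i →
    ExtVanishes R N i

omit [IsLocalRing R] [IsNoetherianRing R] in
theorem IsGorenstein.exists_extVanishesAbove (h : IsGorenstein R) :
    ∃ n, ExtVanishesAbove R n := by
  obtain ⟨n, hn⟩ := h
  exact ⟨n, fun N _ _ _ i hi =>
    CategoryTheory.HasInjectiveDimensionLT.subsingleton _ (n + 1) i hi _⟩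

theorem ExtVanishesAbove.ringKrullDim_le {n d : ℕ} (h : ExtVanishesAbove R n)
    (hd : ringKrullDim R = d) : d ≤ n := by
  by_contra hlt
  have hht : Order.height (IsLocalRing.closedPoint R) = d := by
    rw [← PrimeSpectrum.height_eq_orderHeight]
    have := IsLocalRing.maximalIdeal_height_eq_ringKrullDim (R := R)
    rw [hd] at this
    exact_mod_cast this
  have h1 := mem_support_extR_of_height d _ hht
  have h2 := h (R ⧸ (IsLocalRing.closedPoint R).asIdeal) d (not_le.1 hlt)
  rw [Module.mem_support_iff'] at h1
  obtain ⟨e, he⟩ := h1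
  exact he 1 (fun h1 => (IsLocalRing.closedPoint R).2.ne_top ((Ideal.eq_top_iff_one _).2 h1))
    (@Subsingleton.elim _ h2 _ _)

open RingTheory.Sequence

omit [IsLocalRing R] [IsNoetherianRing R] in
/-- Factoring out a weakly regular sequence of length `l` raises the bound on the degrees where
`Ext^i(-, R)` may be non-zero by at most `l`. -/
theorem extVanishes_quotient_of_isWeaklyRegular (rs : List R) (A : Type u) [AddCommGroup A]
    [Module R A] (hrs : IsWeaklyRegular A rs) (k : ℕ) (hA : ∀ j, k < j → ExtVanishes R A j)
    (j : ℕ) (hj : k + rs.length < j) :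
    ExtVanishes R (A ⧸ (Ideal.ofList rs • ⊤ : Submodule R A)) j := by
  induction rs generalizing A k with
  | nil =>
    exact (hA j hj).congr (Submodule.quotEquivOfEqBot _ (by simp))
  | cons r rs ih =>
    rw [isWeaklyRegular_cons_iff] at hrs
    refine ExtVanishes.congr (ih (QuotSMulTop r A) hrs.2 (k + 1) (fun i hi => ?_) ?_)
      (Submodule.quotOfListConsSMulTopEquivQuotSMulTopInner A r rs)
    · obtain ⟨i, rfl⟩ : ∃ i', i = i' + 1 := ⟨i - 1, by omega⟩
      exact ExtVanishes.right (f := LinearMap.lsmul R A r) hrs.1 (exact_lsmul_mkQ r)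
        (Submodule.mkQ_surjective _) (hA i (by omega)) (hA (i + 1) (by omega))
    · simp only [List.length_cons] at hj; omega

/-- A module with a weakly regular sequence of length `l` in the maximal ideal has vanishing `Ext^i(-, R)` for
`i > k` if all finitely generated modules have for `i > k + l`. -/
theorem ExtVanishesAbove.of_isWeaklyRegular (rs : List R)
    (hm : ∀ r ∈ rs, r ∈ IsLocalRing.maximalIdeal R) (k : ℕ)
    (h : ExtVanishesAbove R (k + rs.length)) (A : Type u) [AddCommGroup A]
    [Module R A] [Module.Finite R A] (hrs : IsWeaklyRegular A rs) (j : ℕ) (hj : k < j) :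
    ExtVanishes R A j := by
  induction rs generalizing A k j with
  | nil => exact h A j hj
  | cons r rs ih =>
    rw [isWeaklyRegular_cons_iff] at hrs
    refine ExtVanishes.of_quotSMulTop (hm r List.mem_cons_self) hrs.1 ?_
    refine ih (fun s hs => hm s (List.mem_cons_of_mem _ hs)) (k + 1) ?_ _ hrs.2 _ (by omega)
    rwa [List.length_cons, add_comm rs.length, ← add_assoc] at h

/-- If a regular sequence in the maximal ideal cannot be prolonged and has length at most `k`,
the bound `k + 1` on the degrees of non-vanishing `Ext` may be lowered to `k`: the residue field
embeds in the quotient by the sequence, which settles `Ext^{k+1}(R/m, R)`, and for a prime `p ≠ m`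
Nakayama's lemma settles `Ext^{k+1}(R/p, R)`. -/
theorem ExtVanishesAbove.pred (rs : List R) (hrs : IsWeaklyRegular R rs)
    (hmax : ∀ r ∈ IsLocalRing.maximalIdeal R, ¬ IsWeaklyRegular R (rs ++ [r]))
    {k : ℕ} (hk : rs.length ≤ k) (h : ExtVanishesAbove R (k + 1)) : ExtVanishesAbove R k := by
  intro N _ _ hN i hi
  obtain hi' | rfl : k + 1 < i ∨ i = k + 1 := by omega
  · exact h N i hi'
  induction hN using IsNoetherianRing.induction_on_isQuotientEquivQuotientPrime R with
  | subsingleton N =>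
    have : Module.Projective R N := Module.Projective.of_free
    exact ExtVanishes.of_projective k
  | exact N₁ N₂ N₃ f g hf hg hfg h₁ h₃ => exact ExtVanishes.middle hf hfg hg h₁ h₃
  | quotient N p e =>
    refine ExtVanishes.congr ?_ e
    by_cases hp : p = IsLocalRing.closedPoint R
    · subst hp
      let Q := R ⧸ (Ideal.ofList rs • ⊤ : Submodule R R)
      have hsimple : IsSimpleModule R (R ⧸ (IsLocalRing.closedPoint R).asIdeal) := by
        rw [isSimpleModule_iff_isCoatom]
        exact (IsLocalRing.maximalIdeal.isMaximal R).out
      have hnot : ¬ Subsingleton ((R ⧸ (IsLocalRing.closedPoint R).asIdeal) →ₗ[R] Q) := by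
        rw [IsSMulRegular.subsingleton_linearMap_iff]
        rintro ⟨r, hr, hreg⟩
        rw [Ideal.annihilator_quotient] at hr
        refine hmax r hr ((isWeaklyRegular_append_iff _ _ _).2 ⟨hrs, ?_⟩)
        rwa [isWeaklyRegular_singleton_iff]
      rw [not_subsingleton_iff_nontrivial] at hnot
      obtain ⟨f, hf⟩ := exists_ne (0 : (R ⧸ (IsLocalRing.closedPoint R).asIdeal) →ₗ[R] Q)
      have hinj : Function.Injective f := LinearMap.injective_of_ne_zero hf
      refine ExtVanishes.left hinj f.exact_map_mkQ_range (Submodule.mkQ_surjective _)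
        ?_ (h _ _ (by omega))
      refine extVanishes_quotient_of_isWeaklyRegular rs R hrs 0 (fun j hj => ?_) _ (by omega)
      obtain ⟨j, rfl⟩ : ∃ j', j = j' + 1 := ⟨j - 1, by omega⟩
      exact ExtVanishes.of_projective j
    · have hlt : p < IsLocalRing.closedPoint R :=
        lt_of_le_of_ne (IsLocalRing.le_maximalIdeal p.2.ne_top) hp
      obtain ⟨x, hx, hxp⟩ := SetLike.exists_of_lt
        (show p.asIdeal < (IsLocalRing.closedPoint R).asIdeal from hlt)
      exact ExtVanishes.of_quotSMulTop hx (isSMulRegular_quotient_of_notMem p hxp)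
        (h _ _ (by omega))

theorem length_le_of_isRegular {M : Type u} [AddCommGroup M] [Module R M] [Module.Finite R M]
    {d : ℕ} (hd : ringKrullDim R = d) {rs : List R} (h : IsRegular M rs) : rs.length ≤ d := by
  have h1 := Module.supportDim_add_length_eq_supportDim_of_isRegular rs h
  have h2 := Module.supportDim_le_ringKrullDim R M
  have : Nontrivial (M ⧸ (Ideal.ofList rs • ⊤ : Submodule R M)) := h.quot_ofList_smul_nontrivial ⊤
  have h3 : 0 ≤ Module.supportDim R (M ⧸ (Ideal.ofList rs • ⊤ : Submodule R M)) := by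
    rw [Module.supportDim]
    exact Order.krullDim_nonneg_iff.2 (Module.nonempty_support_of_nontrivial.to_subtype)
  rw [hd, ← h1] at h2
  have h4 : ((rs.length : ℕ) : WithBot ℕ∞) ≤ (d : ℕ) :=
    le_trans (by simpa using add_le_add_left h3 ((rs.length : ℕ) : WithBot ℕ∞)) h2
  exact_mod_cast h4

/-- A Gorenstein local ring of dimension `d` has injective dimension at most `d` and is
Cohen–Macaulay. -/
theorem IsGorenstein.extVanishesAbove_and_exists_isRegular (hR : IsGorenstein R) {d : ℕ}
    (hd : ringKrullDim R = d) :
    ExtVanishesAbove R d ∧ ∃ rs : List R, rs.length = d ∧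
      (∀ r ∈ rs, r ∈ IsLocalRing.maximalIdeal R) ∧ IsRegular R rs := by
  classical
  let P : ℕ → Prop := fun s => ∃ rs : List R, rs.length = s ∧
      (∀ r ∈ rs, r ∈ IsLocalRing.maximalIdeal R) ∧ IsRegular R rs
  have hle : ∀ s, P s → s ≤ d := by
    rintro s ⟨rs, rfl, -, h⟩
    exact length_le_of_isRegular hd h
  have h0 : P 0 := ⟨[], rfl, by simp, IsRegular.nil R R⟩
  have hspec : P (Nat.findGreatest P d) := Nat.findGreatest_spec (Nat.zero_le d) h0
  obtain ⟨rs, hlen, hm, hreg⟩ := hspec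
  have hmax : ∀ r ∈ IsLocalRing.maximalIdeal R, ¬ IsWeaklyRegular R (rs ++ [r]) := by
    intro r hr hw
    have hm' : ∀ s ∈ rs ++ [r], s ∈ IsLocalRing.maximalIdeal R := by
      intro s hs
      obtain hs | hs := List.mem_append.1 hs
      · exact hm s hs
      · rw [List.mem_singleton.1 hs]; exact hr
    have hP : P (rs.length + 1) :=
      ⟨rs ++ [r], by simp, hm', IsRegular.of_isWeaklyRegular_of_mem_maximalIdeal R hm' hw⟩
    have := Nat.le_findGreatest (hle _ hP) hP
    omega
  obtain ⟨n, hn⟩ := hR.exists_extVanishesAbove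
  have hdesc : ∀ j, ExtVanishesAbove R (rs.length + j) → ExtVanishesAbove R rs.length := by
    intro j
    induction j with
    | zero => exact id
    | succ j ih =>
      exact fun h => ih (ExtVanishesAbove.pred rs hreg.toIsWeaklyRegular hmax (by omega) h)
  have hs : ExtVanishesAbove R rs.length :=
    hdesc n fun N _ _ _ i hi => hn N i (by omega)
  have hd' : rs.length = d := le_antisymm (length_le_of_isRegular hd hreg) (hs.ringKrullDim_le hd)
  exact ⟨hd' ▸ hs, rs, hd', hm, hreg⟩

end Gorenstein

end GrothMod

namespace GrothMod

/-! ### Minimal syzygies -/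

section Ladder

variable {R : Type*} [Ring R] {K F M K' F' M' : Type*}
  [AddCommGroup K] [Module R K] [AddCommGroup F] [Module R F] [AddCommGroup M] [Module R M]
  [AddCommGroup K'] [Module R K'] [AddCommGroup F'] [Module R F'] [AddCommGroup M'] [Module R M']
  {ι : K →ₗ[R] F} {π : F →ₗ[R] M} {ι' : K' →ₗ[R] F'} {π' : F' →ₗ[R] M'}

theorem nonempty_linearEquiv_left (hι : Function.Injective ι) (h : Function.Exact ι π)
    (hι' : Function.Injective ι') (h' : Function.Exact ι' π') (α : F ≃ₗ[R] F') (p : M →ₗ[R] M')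
    (hp : Function.Injective p) (hc : ∀ x, π' (α x) = p (π x)) : Nonempty (K ≃ₗ[R] K') := by
  have hmap : Submodule.map (α : F →ₗ[R] F') (LinearMap.range ι) = LinearMap.range ι' := by
    rw [← h.linearMap_ker_eq, ← h'.linearMap_ker_eq]
    ext y
    constructor
    · rintro ⟨x, hx, rfl⟩
      have hx' : π x = 0 := hx
      change π' (α x) = 0
      rw [hc, hx', map_zero]
    · intro hy
      refine ⟨α.symm y, ?_, α.apply_symm_apply y⟩
      apply hp
      rw [← hc, α.apply_symm_apply, map_zero]
      exact hy
  exact ⟨(LinearEquiv.ofInjective ι hι).trans ((LinearEquiv.ofSubmodules α _ _ hmap).trans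
    (LinearEquiv.ofInjective ι' hι').symm)⟩

theorem nonempty_linearEquiv_right (h : Function.Exact ι π) (hπ : Function.Surjective π)
    (h' : Function.Exact ι' π') (hπ' : Function.Surjective π') (α : F ≃ₗ[R] F') (k : K →ₗ[R] K')
    (hk : Function.Surjective k) (hc : ∀ x, α (ι x) = ι' (k x)) : Nonempty (M ≃ₗ[R] M') := by
  have hmap : Submodule.map (α : F →ₗ[R] F') (LinearMap.range ι) = LinearMap.range ι' := by
    ext y
    constructor
    · rintro ⟨_, ⟨x, rfl⟩, rfl⟩
      exact ⟨k x, (hc x).symm⟩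
    · rintro ⟨x, rfl⟩
      obtain ⟨x, rfl⟩ := hk x
      exact ⟨_, ⟨x, rfl⟩, hc x⟩
  exact ⟨(h.linearEquivOfSurjective hπ).symm.trans ((Submodule.Quotient.equiv _ _ α hmap).trans
    (h'.linearEquivOfSurjective hπ'))⟩

end Ladder

section MinimalSyzygies

variable {R : Type u} [CommRing R]

theorem exists_extension_to_free {K F F' : Type*} [AddCommGroup K] [Module R K] [AddCommGroup F]
    [Module R F] [AddCommGroup F'] [Module R F'] [Module.Free R F'] [Module.Finite R F']
    {ι : K →ₗ[R] F} (h : ∀ φ : K →ₗ[R] R, ∃ ψ : F →ₗ[R] R, ψ ∘ₗ ι = φ) (f : K →ₗ[R] F') :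
    ∃ g : F →ₗ[R] F', g ∘ₗ ι = f := by
  let b := Module.Free.chooseBasis R F'
  choose ψ hψ using fun i => h (b.coord i ∘ₗ f)
  refine ⟨b.equivFun.symm ∘ₗ LinearMap.pi ψ, ?_⟩
  ext x
  rw [LinearMap.comp_apply, LinearMap.comp_apply, LinearEquiv.coe_coe,
    LinearEquiv.symm_apply_eq]
  ext i
  exact LinearMap.congr_fun (hψ i) x

variable [IsLocalRing R]

/-- An endomorphism of a finite free module that is the identity modulo the maximal ideal, as
tested by functionals, is bijective. -/
theorem bijective_of_functional_mem {F : Type*} [AddCommGroup F] [Module R F] [Module.Free R F]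
    [Module.Finite R F] (f : F →ₗ[R] F)
    (h : ∀ (g : F →ₗ[R] R) (x : F), g (f x - x) ∈ IsLocalRing.maximalIdeal R) :
    Function.Bijective f := by
  let b := Module.finBasis R F
  have h1 : Function.Bijective (b.equivFun.toLinearMap ∘ₗ f ∘ₗ
      b.equivFun.symm.toLinearMap) := by
    refine bijective_of_sub_mem _ fun x i => ?_
    have := h (b.coord i) (b.equivFun.symm x)
    have hc : b.coord i (b.equivFun.symm x) = x i :=
      congrFun (b.equivFun.apply_symm_apply x) i
    rw [map_sub, hc] at this
    exact this
  rw [LinearMap.coe_comp, LinearMap.coe_comp] at h1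
  have h2 := (Function.Bijective.of_comp_iff' b.equivFun.bijective _).1 h1
  exact (Function.Bijective.of_comp_iff f b.equivFun.symm.bijective).1 h2

/-- `M` has no non-zero free direct summand; equivalently, as encoded here, no functional on `M`
takes a unit as a value. -/
def NoFreeSummand (R : Type u) [CommRing R] [IsLocalRing R] (M : Type*) [AddCommGroup M]
    [Module R M] : Prop :=
  ∀ (f : M →ₗ[R] R) (x : M), f x ∈ IsLocalRing.maximalIdeal R

section NoFreeSummand

variable {A B : Type*} [AddCommGroup A] [Module R A] [AddCommGroup B] [Module R B]

theorem NoFreeSummand.of_surjective (hA : NoFreeSummand R A) (f : A →ₗ[R] B)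
    (hf : Function.Surjective f) : NoFreeSummand R B := by
  intro g y
  obtain ⟨x, rfl⟩ := hf y
  exact hA (g ∘ₗ f) x

theorem NoFreeSummand.prod (hA : NoFreeSummand R A) (hB : NoFreeSummand R B) :
    NoFreeSummand R (A × B) := by
  intro g x
  have : g x = (g ∘ₗ LinearMap.inl R A B) x.1 + (g ∘ₗ LinearMap.inr R A B) x.2 := by
    simp [← map_add]
  rw [this]
  exact Ideal.add_mem _ (hA _ _) (hB _ _)

theorem NoFreeSummand.subsingleton_of_free [Module.Free R A] (hA : NoFreeSummand R A) :
    Subsingleton A := by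
  let b := Module.Free.chooseBasis R A
  by_cases hι : IsEmpty (Module.Free.ChooseBasisIndex R A)
  · exact b.repr.toEquiv.subsingleton
  · obtain ⟨i⟩ := not_isEmpty_iff.1 hι
    have := hA (b.coord i) (b i)
    rw [Module.Basis.coord_apply, Module.Basis.repr_self, Finsupp.single_eq_same] at this
    exact absurd this ((Ideal.ne_top_iff_one _).1 Ideal.IsPrime.ne_top')

end NoFreeSummand

/-- `K` is a minimal first syzygy of `M`: there is a short exact sequence `0 → K → F → M → 0` with
`F` finite free and `K ⊆ mF`, the inclusion being tested by functionals on `F`. -/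
def IsMinimalSyzygy (R : Type u) [CommRing R] [IsLocalRing R] (K M : Type u) [AddCommGroup K]
    [Module R K] [AddCommGroup M] [Module R M] : Prop :=
  ∃ (F : Type u) (_ : AddCommGroup F) (_ : Module R F) (ι : K →ₗ[R] F) (π : F →ₗ[R] M),
    Module.Free R F ∧ Module.Finite R F ∧ Function.Injective ι ∧ Function.Exact ι π ∧
      Function.Surjective π ∧ ∀ (g : F →ₗ[R] R) (k : K), g (ι k) ∈ IsLocalRing.maximalIdeal R

variable {K M K' M' : Type u} [AddCommGroup K] [Module R K] [AddCommGroup M] [Module R M]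
  [AddCommGroup K'] [Module R K'] [AddCommGroup M'] [Module R M']

/-- Minimal syzygies are unique up to isomorphism. -/
theorem IsMinimalSyzygy.nonempty_equiv (h : IsMinimalSyzygy R K M) (h' : IsMinimalSyzygy R K' M')
    (e : M ≃ₗ[R] M') : Nonempty (K ≃ₗ[R] K') := by
  obtain ⟨F, _, _, ι, π, hF, hfin, hι, hex, hπ, hmin⟩ := h
  obtain ⟨F', _, _, ι', π', hF', hfin', hι', hex', hπ', hmin'⟩ := h'
  obtain ⟨α, hα⟩ := Module.projective_lifting_property π' (e.toLinearMap ∘ₗ π) hπ'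
  obtain ⟨β, hβ⟩ := Module.projective_lifting_property π (e.symm.toLinearMap ∘ₗ π') hπ
  have hα' : ∀ x, π' (α x) = e (π x) := LinearMap.congr_fun hα
  have hβ' : ∀ x, π (β x) = e.symm (π' x) := LinearMap.congr_fun hβ
  have h1 : Function.Bijective (β ∘ₗ α) := by
    refine bijective_of_functional_mem _ fun g x => ?_
    obtain ⟨k, hk⟩ := (hex ((β ∘ₗ α) x - x)).1 (by simp [hα', hβ'])
    rw [← hk]; exact hmin g k
  have h2 : Function.Bijective (α ∘ₗ β) := by
    refine bijective_of_functional_mem _ fun g x => ?_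
    obtain ⟨k, hk⟩ := (hex' ((α ∘ₗ β) x - x)).1 (by simp [hα', hβ'])
    rw [← hk]; exact hmin' g k
  have hbij : Function.Bijective α :=
    ⟨Function.Injective.of_comp h1.1, Function.Surjective.of_comp h2.2⟩
  exact nonempty_linearEquiv_left hι hex hι' hex' (LinearEquiv.ofBijective α hbij) e.toLinearMap
    e.injective hα'

/-- A module without free summand on which functionals of its minimal syzygy extend is determined
by this syzygy. -/
theorem IsMinimalSyzygy.nonempty_equiv_of_extVanishes (h : IsMinimalSyzygy R K M)
    (h' : IsMinimalSyzygy R K' M') (e : K ≃ₗ[R] K') (hM : ExtVanishes R M 1)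
    (hM' : ExtVanishes R M' 1) (hn : NoFreeSummand R M) (hn' : NoFreeSummand R M') :
    Nonempty (M ≃ₗ[R] M') := by
  obtain ⟨F, _, _, ι, π, hF, hfin, hι, hex, hπ, hmin⟩ := h
  obtain ⟨F', _, _, ι', π', hF', hfin', hι', hex', hπ', hmin'⟩ := h'
  obtain ⟨α, hα⟩ := exists_extension_to_free (hM.exists_extension hι hex hπ) (ι' ∘ₗ e.toLinearMap)
  obtain ⟨β, hβ⟩ := exists_extension_to_free (hM'.exists_extension hι' hex' hπ')
    (ι ∘ₗ e.symm.toLinearMap)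
  have hα' : ∀ x, α (ι x) = ι' (e x) := LinearMap.congr_fun hα
  have hβ' : ∀ x, β (ι' x) = ι (e.symm x) := LinearMap.congr_fun hβ
  -- a functional vanishing on the syzygy factors through the module, so has no unit values
  have h1 : Function.Bijective (β ∘ₗ α) := by
    refine bijective_of_functional_mem _ fun g x => ?_
    have := hn.of_surjective _ (hex.linearEquivOfSurjective hπ).symm.surjective
    exact this (Submodule.liftQ _ (g ∘ₗ (β ∘ₗ α - LinearMap.id)) (by
      rintro _ ⟨k, rfl⟩; simp [hα', hβ'])) (Submodule.Quotient.mk x)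
  have h2 : Function.Bijective (α ∘ₗ β) := by
    refine bijective_of_functional_mem _ fun g x => ?_
    have := hn'.of_surjective _ (hex'.linearEquivOfSurjective hπ').symm.surjective
    exact this (Submodule.liftQ _ (g ∘ₗ (α ∘ₗ β - LinearMap.id)) (by
      rintro _ ⟨k, rfl⟩; simp [hα', hβ'])) (Submodule.Quotient.mk x)
  have hbij : Function.Bijective α :=
    ⟨Function.Injective.of_comp h1.1, Function.Surjective.of_comp h2.2⟩
  exact nonempty_linearEquiv_right hex hπ hex' hπ' (LinearEquiv.ofBijective α hbij) e.toLinearMap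
    e.surjective hα'

theorem IsMinimalSyzygy.pi {I : Type} [Fintype I] {K M : I → Type u} [∀ i, AddCommGroup (K i)]
    [∀ i, Module R (K i)] [∀ i, AddCommGroup (M i)] [∀ i, Module R (M i)]
    (h : ∀ i, IsMinimalSyzygy R (K i) (M i)) :
    IsMinimalSyzygy R (∀ i, K i) (∀ i, M i) := by
  classical
  choose F i1 i2 ι π hF hfin hι hex hπ hmin using h
  refine ⟨∀ i, F i, inferInstance, inferInstance,
    LinearMap.pi fun i => ι i ∘ₗ LinearMap.proj i,
    LinearMap.pi fun i => π i ∘ₗ LinearMap.proj i, inferInstance, inferInstance, ?_, ?_, ?_, ?_⟩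
  · exact fun x y hxy => funext fun i => hι i (congrFun hxy i)
  · intro y
    constructor
    · intro hy
      choose k hk using fun i => (hex i (y i)).1 (congrFun hy i)
      exact ⟨k, funext hk⟩
    · rintro ⟨k, rfl⟩
      exact funext fun i => (hex i _).2 ⟨k i, rfl⟩
  · intro y
    choose x hx using fun i => hπ i (y i)
    exact ⟨x, funext hx⟩
  · intro g k
    rw [← Finset.univ_sum_single ((LinearMap.pi fun i => ι i ∘ₗ LinearMap.proj i) k), map_sum]
    exact Ideal.sum_mem _ fun i _ => hmin i (g ∘ₗ LinearMap.single R F i) (k i)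

theorem IsMinimalSyzygy.prod (h : IsMinimalSyzygy R K M) (h' : IsMinimalSyzygy R K' M') :
    IsMinimalSyzygy R (K × K') (M × M') := by
  obtain ⟨F, _, _, ι, π, hF, hfin, hι, hex, hπ, hmin⟩ := h
  obtain ⟨F', _, _, ι', π', hF', hfin', hι', hex', hπ', hmin'⟩ := h'
  refine ⟨F × F', inferInstance, inferInstance, ι.prodMap ι', π.prodMap π', inferInstance,
    inferInstance, hι.prodMap hι', ?_, hπ.prodMap hπ', ?_⟩
  · rintro ⟨y, y'⟩
    constructor
    · intro hy
      obtain ⟨k, hk⟩ := (hex y).1 (congrArg Prod.fst hy)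
      obtain ⟨k', hk'⟩ := (hex' y').1 (congrArg Prod.snd hy)
      exact ⟨(k, k'), Prod.ext hk hk'⟩
    · rintro ⟨⟨k, k'⟩, hk⟩
      exact Prod.ext ((hex y).2 ⟨k, congrArg Prod.fst hk⟩) ((hex' y').2 ⟨k', congrArg Prod.snd hk⟩)
  · intro g k
    have : g (ι.prodMap ι' k) = (g ∘ₗ LinearMap.inl R F F') (ι k.1) +
        (g ∘ₗ LinearMap.inr R F F') (ι' k.2) := by
      simp [← map_add]
    rw [this]
    exact Ideal.add_mem _ (hmin _ _) (hmin' _ _)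

theorem isMinimalSyzygy_of_free (K F : Type u) [AddCommGroup K] [Module R K] [Subsingleton K]
    [AddCommGroup F] [Module R F] [Module.Free R F] [Module.Finite R F] :
    IsMinimalSyzygy R K F :=
  ⟨F, inferInstance, inferInstance, 0, LinearMap.id, inferInstance, inferInstance,
    Function.injective_of_subsingleton _,
    fun y => ⟨fun hy => ⟨0, hy.symm⟩, fun ⟨_, hk⟩ => hk.symm⟩, Function.surjective_id,
    fun g k => by simp⟩

theorem IsMinimalSyzygy.free_of_subsingleton [Subsingleton K] (h : IsMinimalSyzygy R K M) :
    Module.Free R M := by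
  obtain ⟨F, _, _, ι, π, hF, hfin, hι, hex, hπ, hmin⟩ := h
  refine Module.Free.of_equiv (LinearEquiv.ofBijective π ⟨?_, hπ⟩)
  rw [injective_iff_map_eq_zero]
  intro x hx
  obtain ⟨k, rfl⟩ := (hex x).1 hx
  rw [Subsingleton.elim k 0, map_zero]

theorem IsMinimalSyzygy.subsingleton_of_subsingleton
    (h : IsMinimalSyzygy R K M) (hM : Subsingleton M) : Subsingleton K := by
  obtain ⟨e⟩ := h.nonempty_equiv (isMinimalSyzygy_of_free PUnit M) (LinearEquiv.refl R M)
  exact e.toEquiv.subsingleton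

omit [IsLocalRing R] in
theorem nonempty_prod_of_exact {A B C : Type*} [AddCommGroup A] [Module R A] [AddCommGroup B]
    [Module R B] [AddCommGroup C] [Module R C] [Module.Projective R C] {f : A →ₗ[R] B}
    {g : B →ₗ[R] C} (hf : Function.Injective f) (hfg : Function.Exact f g)
    (hg : Function.Surjective g) : Nonempty (B ≃ₗ[R] A × C) := by
  obtain ⟨l, hl⟩ := Module.projective_lifting_property g LinearMap.id hg
  exact ⟨(hfg.splitSurjectiveEquiv hf ⟨l, hl⟩).1⟩

omit [IsLocalRing R] in
/-- Schanuel's lemma. -/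
theorem nonempty_equiv_prod_of_exact {K P K' P' M : Type*} [AddCommGroup K] [Module R K]
    [AddCommGroup P] [Module R P] [AddCommGroup K'] [Module R K'] [AddCommGroup P'] [Module R P']
    [AddCommGroup M] [Module R M] [Module.Projective R P] [Module.Projective R P']
    {ι : K →ₗ[R] P} {π : P →ₗ[R] M} (hι : Function.Injective ι) (h : Function.Exact ι π)
    (hπ : Function.Surjective π) {ι' : K' →ₗ[R] P'} {π' : P' →ₗ[R] M}
    (hι' : Function.Injective ι') (h' : Function.Exact ι' π') (hπ' : Function.Surjective π') :
    Nonempty ((K × P') ≃ₗ[R] (K' × P)) := by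
  -- both sides are the fibre product of `P` and `P'` over `M`
  let X := LinearMap.ker (π ∘ₗ LinearMap.fst R P P' - π' ∘ₗ LinearMap.snd R P P')
  have hX : ∀ x : P × P', x ∈ X ↔ π x.1 = π' x.2 := fun x => by
    simp [X, sub_eq_zero]
  obtain ⟨e⟩ := nonempty_prod_of_exact (R := R) (A := K) (B := X) (C := P')
    (f := (LinearMap.inl R P P' ∘ₗ ι).codRestrict X
      (fun k => (hX _).2 (by simpa using (h _).2 ⟨k, rfl⟩)))
    (g := LinearMap.snd R P P' ∘ₗ X.subtype)
    (fun a b hab => hι (congrArg (fun x : X => x.1.1) hab))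
    (fun x => ⟨fun hx => by
        have hx' : x.1.2 = 0 := hx
        obtain ⟨k, hk⟩ := (h x.1.1).1 (by rw [(hX _).1 x.2, hx', map_zero])
        exact ⟨k, Subtype.ext (Prod.ext hk hx'.symm)⟩, fun ⟨k, hk⟩ => by
        rw [← hk]; rfl⟩)
    (fun y => by
      obtain ⟨x, hx⟩ := hπ (π' y)
      exact ⟨⟨(x, y), (hX _).2 hx⟩, rfl⟩)
  obtain ⟨e'⟩ := nonempty_prod_of_exact (R := R) (A := K') (B := X) (C := P)
    (f := (LinearMap.inr R P P' ∘ₗ ι').codRestrict X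
      (fun k => (hX _).2 (by simpa using ((h' _).2 ⟨k, rfl⟩).symm)))
    (g := LinearMap.fst R P P' ∘ₗ X.subtype)
    (fun a b hab => hι' (congrArg (fun x : X => x.1.2) hab))
    (fun x => ⟨fun hx => by
        have hx' : x.1.1 = 0 := hx
        obtain ⟨k, hk⟩ := (h' x.1.2).1 (by rw [← (hX _).1 x.2, hx', map_zero])
        exact ⟨k, Subtype.ext (Prod.ext hx'.symm hk)⟩, fun ⟨k, hk⟩ => by
        rw [← hk]; rfl⟩)
    (fun y => by
      obtain ⟨x, hx⟩ := hπ' (π y)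
      exact ⟨⟨(y, x), (hX _).2 hx.symm⟩, rfl⟩)
  exact ⟨e.symm.trans e'⟩

/-- Adding a finite free module does not change the minimal syzygy. -/
theorem IsMinimalSyzygy.prod_free (h : IsMinimalSyzygy R K M) (F : Type u) [AddCommGroup F]
    [Module R F] [Module.Free R F] [Module.Finite R F] :
    IsMinimalSyzygy R (K × PUnit.{u + 1}) (M × F) :=
  h.prod (isMinimalSyzygy_of_free PUnit F)

/-- Minimal syzygies of arbitrary first syzygies of the same module are isomorphic. -/
theorem IsMinimalSyzygy.nonempty_equiv_of_exact {L L' P P' N : Type u} [AddCommGroup L]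
    [Module R L] [AddCommGroup L'] [Module R L'] [AddCommGroup P] [Module R P] [AddCommGroup P']
    [Module R P'] [AddCommGroup N] [Module R N] [Module.Free R P] [Module.Finite R P]
    [Module.Free R P'] [Module.Finite R P']
    {ι : L →ₗ[R] P} {π : P →ₗ[R] N} (hι : Function.Injective ι) (hex : Function.Exact ι π)
    (hπ : Function.Surjective π) {ι' : L' →ₗ[R] P'} {π' : P' →ₗ[R] N}
    (hι' : Function.Injective ι') (hex' : Function.Exact ι' π') (hπ' : Function.Surjective π')
    (h : IsMinimalSyzygy R K L) (h' : IsMinimalSyzygy R K' L') : Nonempty (K ≃ₗ[R] K') := by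
  obtain ⟨e⟩ := nonempty_equiv_prod_of_exact hι hex hπ hι' hex' hπ'
  obtain ⟨e'⟩ := (h.prod_free P').nonempty_equiv (h'.prod_free P) e
  exact ⟨LinearEquiv.prodUnique.symm.trans (e'.trans LinearEquiv.prodUnique)⟩

omit [IsLocalRing R] in
theorem IsFreeCover.surjective {G M : Type u} [AddCommGroup G] [Module R G] [AddCommGroup M]
    [Module R M] {φ : G →ₗ[R] M} (h : IsFreeCover φ) : Function.Surjective φ := by
  intro m
  obtain ⟨f, hf⟩ := h.factors R (LinearMap.toSpanSingleton R M m)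
  exact ⟨f 1, by rw [← LinearMap.comp_apply, ← hf, LinearMap.toSpanSingleton_apply, one_smul]⟩

/-- The kernel of a finite free cover is a minimal syzygy: if a functional `g` took the value `1`
at a point `x` of the kernel, `y ↦ y - g(y) x` would be a non-injective endomorphism over `M`. -/
theorem IsFreeCover.isMinimalSyzygy {G M : Type u} [AddCommGroup G] [Module R G]
    [Module.Finite R G] [AddCommGroup M] [Module R M] {φ : G →ₗ[R] M} (h : IsFreeCover φ) :
    IsMinimalSyzygy R (LinearMap.ker φ) M := by
  refine ⟨G, inferInstance, inferInstance, (LinearMap.ker φ).subtype, φ, h.free, inferInstance,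
    Submodule.injective_subtype _, LinearMap.exact_subtype_ker_map φ, h.surjective, ?_⟩
  intro g ⟨x, hx⟩
  by_contra hunit
  rw [IsLocalRing.mem_maximalIdeal, mem_nonunits_iff, not_not] at hunit
  obtain ⟨v, hv⟩ := hunit
  have hv' : g x = v := hv.symm
  let g' : G →ₗ[R] R := (↑v⁻¹ : R) • g
  have hg' : g' x = 1 := by simp [g', hv']
  have hx0 : φ x = 0 := hx
  have hb := h.automorphism (LinearMap.id - g'.smulRight x) (by ext y; simp [hx0])
  have hx' : x = 0 := hb.1 (by simp [hg'])
  rw [hx', map_zero] at hg'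
  exact zero_ne_one hg'

omit [IsLocalRing R] in
theorem IsFreeEnvelope.exists_extension {M G : Type u} [AddCommGroup M] [Module R M]
    [AddCommGroup G] [Module R G] {φ : M →ₗ[R] G} (h : IsFreeEnvelope φ) (f : M →ₗ[R] R) :
    ∃ g : G →ₗ[R] R, g ∘ₗ φ = f := by
  obtain ⟨g, hg⟩ := h.factors R f
  exact ⟨g, hg.symm⟩

/-- The cokernel of a free envelope has no free summand: if a functional `g` vanishing on `M` took
the value `1` at `x`, `y ↦ y - g(y) x` would be a non-injective endomorphism under `M`. -/
theorem IsFreeEnvelope.noFreeSummand {M G : Type u} [AddCommGroup M] [Module R M]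
    [AddCommGroup G] [Module R G] {φ : M →ₗ[R] G} (h : IsFreeEnvelope φ) :
    NoFreeSummand R (G ⧸ LinearMap.range φ) := by
  intro g x
  obtain ⟨x, rfl⟩ := Submodule.mkQ_surjective _ x
  by_contra hunit
  rw [IsLocalRing.mem_maximalIdeal, mem_nonunits_iff, not_not] at hunit
  obtain ⟨v, hv⟩ := hunit
  let g' : G →ₗ[R] R := (↑v⁻¹ : R) • (g ∘ₗ (LinearMap.range φ).mkQ)
  have hg' : g' x = 1 := by
    change (↑v⁻¹ : R) * g ((LinearMap.range φ).mkQ x) = 1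
    rw [← hv, Units.inv_mul]
  have hφ : ∀ m, g' (φ m) = 0 := fun m => by
    have : (LinearMap.range φ).mkQ (φ m) = 0 := by simp
    change (↑v⁻¹ : R) * g ((LinearMap.range φ).mkQ (φ m)) = 0
    rw [this, map_zero, mul_zero]
  have hb := h.automorphism (LinearMap.id - g'.smulRight x) (by ext y; simp [hφ])
  have hx' : x = 0 := hb.1 (by simp [hg'])
  rw [hx', map_zero] at hg'
  exact zero_ne_one hg'

/-- A module without free summand that embeds in a finite free module is a minimal syzygy of the
cokernel. -/
theorem NoFreeSummand.isMinimalSyzygy {F : Type u} [AddCommGroup F] [Module R F]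
    [Module.Free R F] [Module.Finite R F] (hK : NoFreeSummand R K) {ι : K →ₗ[R] F}
    (hι : Function.Injective ι) : IsMinimalSyzygy R K (F ⧸ LinearMap.range ι) :=
  ⟨F, inferInstance, inferInstance, ι, (LinearMap.range ι).mkQ, inferInstance, inferInstance, hι,
    ι.exact_map_mkQ_range, Submodule.mkQ_surjective _, fun g k => hK (g ∘ₗ ι) k⟩

/-- Functionals on a minimal syzygy of `M` have no unit values if they extend to the free
module, which is the case for `Ext^1(M, R) = 0`. -/
theorem IsMinimalSyzygy.noFreeSummand (h : IsMinimalSyzygy R K M) (hM : ExtVanishes R M 1) :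
    NoFreeSummand R K := by
  obtain ⟨F, _, _, ι, π, hF, hfin, hι, hex, hπ, hmin⟩ := h
  intro f k
  obtain ⟨g, rfl⟩ := hM.exists_extension hι hex hπ f
  exact hmin g k

theorem IsMinimalSyzygy.extVanishes (h : IsMinimalSyzygy R K M) {i : ℕ}
    (hM : ExtVanishes R M (i + 2)) : ExtVanishes R K (i + 1) := by
  obtain ⟨F, _, _, ι, π, hF, hfin, hι, hex, hπ, hmin⟩ := h
  exact ExtVanishes.left hι hex hπ (ExtVanishes.of_projective i) hM

end MinimalSyzygies

end GrothMod

namespace GrothMod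

open CategoryTheory CategoryTheory.Abelian

/-! ### Modules with vanishing `Ext^i(M, R)` -/

section DualAcyclic

variable {R : Type u} [CommRing R]

/-- The condition `Ext^i(M, R) = 0` for all `i > 0`. -/
def DualAcyclic (R : Type u) [CommRing R] (M : Type u) [AddCommGroup M] [Module R M] : Prop :=
  ∀ i : ℕ, ExtVanishes R M (i + 1)

variable {M N : Type u} [AddCommGroup M] [Module R M] [AddCommGroup N] [Module R N]

theorem DualAcyclic.of_retract (hN : DualAcyclic R N) (s : M →ₗ[R] N) (r : N →ₗ[R] M)
    (hrs : r ∘ₗ s = LinearMap.id) : DualAcyclic R M :=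
  fun i => (hN i).of_retract s r hrs

theorem DualAcyclic.prod (hM : DualAcyclic R M) (hN : DualAcyclic R N) :
    DualAcyclic R (M × N) :=
  fun i => ExtVanishes.middle (f := LinearMap.inl R M N) (g := LinearMap.snd R M N)
    LinearMap.inl_injective Function.Exact.inl_snd LinearMap.snd_surjective (hM i) (hN i)

variable [IsLocalRing R]

theorem IsMinimalSyzygy.dualAcyclic (h : IsMinimalSyzygy R M N) (hN : DualAcyclic R N) :
    DualAcyclic R M :=
  fun i => h.extVanishes (hN (i + 1))

variable [IsNoetherianRing R]

omit [IsLocalRing R] [IsNoetherianRing R] in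
theorem exact_dualMap {K F M : Type*} [AddCommGroup K] [Module R K] [AddCommGroup F] [Module R F]
    [AddCommGroup M] [Module R M] {ι : K →ₗ[R] F} {π : F →ₗ[R] M} (h : Function.Exact ι π)
    (hπ : Function.Surjective π) : Function.Exact π.dualMap ι.dualMap := by
  intro g
  constructor
  · intro hg
    have hle : LinearMap.range ι ≤ LinearMap.ker g := by
      rintro _ ⟨k, rfl⟩
      exact LinearMap.congr_fun hg k
    refine ⟨Submodule.liftQ _ g hle ∘ₗ (h.linearEquivOfSurjective hπ).symm.toLinearMap, ?_⟩
    · ext x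
      change Submodule.liftQ _ g hle ((h.linearEquivOfSurjective hπ).symm (π x)) = g x
      rw [h.linearEquivOfSurjective_symm_apply, Submodule.liftQ_apply]
  · rintro ⟨f, rfl⟩
    ext k
    change f (π (ι k)) = 0
    rw [(h _).2 ⟨k, rfl⟩, map_zero]

theorem exists_finite_isMinimalSyzygy (M : Type u) [AddCommGroup M] [Module R M]
    [Module.Finite R M] :
    ∃ (K : Type u) (_ : AddCommGroup K) (_ : Module R K), Module.Finite R K ∧
      IsMinimalSyzygy R K M := by
  obtain ⟨n, φ, hφ⟩ := exists_isFreeCover (R := R) M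
  exact ⟨LinearMap.ker φ, inferInstance, inferInstance, inferInstance, hφ.isMinimalSyzygy⟩

/-- If the injective dimension of `R` is finite, the dual of a module with `Ext^i(M, R) = 0` for
all `i > 0` has the same property: dualizing a free resolution of `M` exhibits `M*` as a `j`-th
syzygy, for every `j`, of the dual of the `j`-th syzygy of `M`. -/
theorem DualAcyclic.dual {d : ℕ} (hR : ExtVanishesAbove R d) [Module.Finite R M]
    (hM : DualAcyclic R M) : DualAcyclic R (Module.Dual R M) := by
  have key : ∀ (j : ℕ) (M : Type u) [AddCommGroup M] [Module R M] [Module.Finite R M],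
      DualAcyclic R M → ∀ i, d < i + 1 + j → ExtVanishes R (Module.Dual R M) (i + 1) := by
    intro j
    induction j with
    | zero => exact fun M _ _ _ _ i hi => hR _ _ hi
    | succ j ih =>
      intro M _ _ _ hM i hi
      obtain ⟨K, _, _, hK, hs⟩ := exists_finite_isMinimalSyzygy (R := R) M
      have hKa := hs.dualAcyclic hM
      obtain ⟨F, _, _, ι, π, hF, hfin, hι, hex, hπ, -⟩ := hs
      exact ExtVanishes.left (LinearMap.dualMap_injective_of_surjective hπ) (exact_dualMap hex hπ)
        (fun f => (hM 0).exists_extension hι hex hπ f) (ExtVanishes.of_projective i)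
        (ih K hKa (i + 1) (by omega))
  exact fun i => key d M hM i (by omega)

/-- A finitely generated `M` with `Ext^i(M, R) = 0` for all `i > 0` is torsionless. In a
presentation with syzygies `0 → K → F → M → 0` and `0 → L → G → K → 0`, a point `y` of `F` lying
over a point of `M` killed by all functionals defines a functional on `K*`; by
`Ext^1(L*, R) = 0` it extends to `G*`, hence is evaluation at a point of `K`, which must be `y`. -/
theorem DualAcyclic.eq_zero_of_forall_dual {d : ℕ} (hR : ExtVanishesAbove R d)
    [Module.Finite R M] (hM : DualAcyclic R M) (m : M) (hm : ∀ f : M →ₗ[R] R, f m = 0) :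
    m = 0 := by
  obtain ⟨K, _, _, hK, hs⟩ := exists_finite_isMinimalSyzygy (R := R) M
  have hKa := hs.dualAcyclic hM
  obtain ⟨L, _, _, hL, hs'⟩ := exists_finite_isMinimalSyzygy (R := R) K
  have hLa := hs'.dualAcyclic hKa
  obtain ⟨F, _, _, ι, π, hF, hfin, hι, hex, hπ, -⟩ := hs
  obtain ⟨G, _, _, ι', π', hG, hfin', hι', hex', hπ', -⟩ := hs'
  obtain ⟨y, rfl⟩ := hπ m
  have hexd := exact_dualMap hex hπ
  have hsurj : Function.Surjective ι.dualMap := fun f => (hM 0).exists_extension hι hex hπ f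
  have hle : LinearMap.range π.dualMap ≤ LinearMap.ker (Module.Dual.eval R F y) := by
    rintro _ ⟨f, rfl⟩; exact hm f
  let Θ : Module.Dual R K →ₗ[R] R :=
    Submodule.liftQ _ (Module.Dual.eval R F y) hle ∘ₗ
      (hexd.linearEquivOfSurjective hsurj).symm.toLinearMap
  have hΘ : ∀ g : Module.Dual R F, Θ (ι.dualMap g) = g y := by
    intro g
    change Submodule.liftQ _ (Module.Dual.eval R F y) hle
      ((hexd.linearEquivOfSurjective hsurj).symm (ι.dualMap g)) = g y
    rw [hexd.linearEquivOfSurjective_symm_apply, Submodule.liftQ_apply]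
    rfl
  obtain ⟨Ξ, hΞ⟩ := (hLa.dual hR 0).exists_extension
    (LinearMap.dualMap_injective_of_surjective hπ') (exact_dualMap hex' hπ')
    (fun f => (hKa 0).exists_extension hι' hex' hπ' f) Θ
  obtain ⟨z, rfl⟩ := (Module.evalEquiv R G).surjective Ξ
  have hy : y = ι (π' z) := by
    rw [← sub_eq_zero, ← Module.forall_dual_apply_eq_zero_iff R]
    intro g
    rw [map_sub, ← hΘ, ← hΞ, sub_eq_zero]
    rfl
  rw [hy]
  exact (hex _).2 ⟨_, rfl⟩

/-- A free envelope of a finitely generated module with `Ext^i(M, R) = 0` for all `i > 0` is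
injective. -/
theorem IsFreeEnvelope.injective {d : ℕ} (hR : ExtVanishesAbove R d) [Module.Finite R M]
    (hM : DualAcyclic R M) {G : Type u} [AddCommGroup G] [Module R G] {φ : M →ₗ[R] G}
    (h : IsFreeEnvelope φ) : Function.Injective φ := by
  rw [injective_iff_map_eq_zero]
  intro m hm
  refine hM.eq_zero_of_forall_dual hR m fun f => ?_
  obtain ⟨g, rfl⟩ := h.exists_extension f
  rw [LinearMap.comp_apply, hm, map_zero]

omit [IsLocalRing R] [IsNoetherianRing R] in
theorem DualAcyclic.quotient_range {F : Type u} [AddCommGroup F] [Module R F] [Module.Free R F]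
    {φ : M →ₗ[R] F} (hM : DualAcyclic R M) (hφ : Function.Injective φ)
    (h : ∀ f : M →ₗ[R] R, ∃ g : F →ₗ[R] R, g ∘ₗ φ = f) :
    DualAcyclic R (F ⧸ LinearMap.range φ) := by
  rintro (_ | i)
  · exact ExtVanishes.one_of_extension hφ φ.exact_map_mkQ_range (Submodule.mkQ_surjective _) h
  · exact ExtVanishes.right hφ φ.exact_map_mkQ_range (Submodule.mkQ_surjective _) (hM i)
      (ExtVanishes.of_projective (i + 1))

end DualAcyclic

/-! ### Maximal Cohen–Macaulay modules -/

section MCM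

variable {R : Type u} [CommRing R] [IsLocalRing R] [IsNoetherianRing R]

open RingTheory.Sequence

theorem isMCM_iff_exists_isRegular {d : ℕ} (hd : ringKrullDim R = d) (M : Type u)
    [AddCommGroup M] [Module R M] [Module.Finite R M] :
    IsMCM R M ↔ Nontrivial M ∧ ∃ rs : List R, rs.length = d ∧
      (∀ r ∈ rs, r ∈ IsLocalRing.maximalIdeal R) ∧ IsRegular M rs := by
  refine and_congr_right fun hM => ?_
  have hcast : (depth R M : WithBot ℕ∞) = ringKrullDim R ↔ depth R M = d := by
    rw [hd]; exact_mod_cast Iff.rfl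
  have hle : depth R M ≤ d := by
    refine iSup_le fun rs => iSup_le fun _ => iSup_le fun h => ?_
    exact_mod_cast length_le_of_isRegular hd h
  rw [hcast]
  constructor
  · intro h
    by_contra hno
    obtain _ | e := d
    · exact hno ⟨[], rfl, by simp, IsRegular.nil R M⟩
    have : depth R M ≤ e := by
      refine iSup_le fun rs => iSup_le fun hm => iSup_le fun hr => ?_
      have h1 := length_le_of_isRegular hd hr
      have h2 : rs.length ≠ e + 1 := fun h2 => hno ⟨rs, h2, hm, hr⟩
      have h3 : rs.length ≤ e := by omega
      exact_mod_cast h3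
    rw [h] at this
    norm_cast at this
    omega
  · rintro ⟨rs, hl, hm, hr⟩
    refine le_antisymm hle ?_
    rw [← hl]
    exact le_iSup_of_le rs (le_iSup_of_le hm (le_iSup_of_le hr le_rfl))

omit [IsNoetherianRing R] in
theorem maximalIdeal_smul_top_lt (M : Type u) [AddCommGroup M] [Module R M]
    [Module.Finite R M] [Nontrivial M] :
    IsLocalRing.maximalIdeal R • (⊤ : Submodule R M) < ⊤ :=
  lt_top_iff_ne_top.2 (Submodule.top_ne_ideal_smul_of_le_jacobson_annihilator
    (IsLocalRing.maximalIdeal_le_jacobson _)).symm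

omit [IsLocalRing R] [IsNoetherianRing R] in
theorem support_quotient_eq (I : Ideal R) :
    Module.support R (R ⧸ I) = PrimeSpectrum.zeroLocus I := by
  rw [Module.support_eq_zeroLocus, Ideal.annihilator_quotient]

theorem subsingleton_ext_residue_of_free {rs : List R}
    (hm : ∀ r ∈ rs, r ∈ IsLocalRing.maximalIdeal R) (hrs : IsWeaklyRegular R rs) (i : ℕ)
    (hi : i < rs.length) (F : Type u) [AddCommGroup F] [Module R F] [Module.Free R F]
    [Module.Finite R F] :
    Subsingleton (Ext (ModuleCat.of R (R ⧸ IsLocalRing.maximalIdeal R)) (ModuleCat.of R F) i) := by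
  obtain hF | hF := subsingleton_or_nontrivial F
  · refine subsingleton_of_forall_eq 0 fun x => ?_
    have : 𝟙 (ModuleCat.of R F) = 0 := by
      ext y; exact Subsingleton.elim (α := F) _ _
    rw [← Ext.comp_mk₀_id x, this, Ext.mk₀_zero, Ext.comp_zero]
  · have hw : IsWeaklyRegular F rs :=
      ((TensorProduct.rid R F).isWeaklyRegular_congr rs).1 hrs.isWeaklyRegular_lTensor
    have hfin : Module.Finite R (ModuleCat.of R F) := ‹Module.Finite R F›
    have hfin' : Module.Finite R (ModuleCat.of R (R ⧸ IsLocalRing.maximalIdeal R)) :=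
      inferInstanceAs (Module.Finite R (R ⧸ IsLocalRing.maximalIdeal R))
    exact ModuleCat.subsingleton_ext_of_exists_isRegular (IsLocalRing.maximalIdeal R) _
      (support_quotient_eq _).subset (ModuleCat.of R F) (maximalIdeal_smul_top_lt F) rs hm
      (IsRegular.of_isWeaklyRegular_of_mem_maximalIdeal F hm hw) i hi

/-- If `R` has a regular sequence of length `d`, then `Ext^i(k, M) = 0` for `i < d`: such an `M`
embeds in a free module with cokernel of the same kind, which allows induction on `i`. -/
theorem DualAcyclic.subsingleton_ext_residue {d : ℕ} (hR : ExtVanishesAbove R d) {rs : List R}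
    (hm : ∀ r ∈ rs, r ∈ IsLocalRing.maximalIdeal R) (hrs : IsWeaklyRegular R rs) (i : ℕ)
    (hi : i < rs.length) (M : Type u) [AddCommGroup M] [Module R M] [Module.Finite R M]
    (hM : DualAcyclic R M) :
    Subsingleton (Ext (ModuleCat.of R (R ⧸ IsLocalRing.maximalIdeal R)) (ModuleCat.of R M) i) := by
  induction i generalizing M with
  | zero =>
    obtain ⟨n, φ, hφ⟩ := exists_isFreeEnvelope (R := R) M
    have S := shortExact_of_exact (hφ.injective hR hM) φ.exact_map_mkQ_range
      (Submodule.mkQ_surjective _)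
    have hmono : Mono (ModuleCat.ofHom φ) := S.mono_f
    have h0 := subsingleton_ext_residue_of_free hm hrs 0 hi (Fin n → R)
    exact (Ext.postcomp_mk₀_injective_of_mono _ (ModuleCat.ofHom φ)).subsingleton
  | succ i ih =>
    obtain ⟨n, φ, hφ⟩ := exists_isFreeEnvelope (R := R) M
    have hinj := hφ.injective hR hM
    have S := shortExact_of_exact hinj φ.exact_map_mkQ_range (Submodule.mkQ_surjective _)
    have h0 := subsingleton_ext_residue_of_free hm hrs (i + 1) hi (Fin n → R)
    have h1 := ih (by omega) ((Fin n → R) ⧸ LinearMap.range φ)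
      (hM.quotient_range hinj hφ.exists_extension)
    refine subsingleton_of_forall_eq 0 fun x => ?_
    obtain ⟨x', rfl⟩ := Ext.covariant_sequence_exact₁ _ S x (@Subsingleton.elim _ h0 _ _)
      (n₀ := i) rfl
    rw [@Subsingleton.elim _ h1 x' 0, Ext.zero_comp]

/-- Over a Gorenstein local ring, the maximal Cohen–Macaulay modules are the non-zero modules with
`Ext^i(M, R) = 0` for all `i > 0`. -/
theorem isMCM_iff_dualAcyclic (hR : IsGorenstein R) {d : ℕ} (hd : ringKrullDim R = d)
    (M : Type u) [AddCommGroup M] [Module R M] [Module.Finite R M] :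
    IsMCM R M ↔ Nontrivial M ∧ DualAcyclic R M := by
  obtain ⟨hE, rs, rfl, hm, hrs⟩ := hR.extVanishesAbove_and_exists_isRegular hd
  rw [isMCM_iff_exists_isRegular hd]
  refine and_congr_right fun hM => ⟨?_, fun h => ?_⟩
  · rintro ⟨ss, hl, hss, hreg⟩ i
    refine ExtVanishesAbove.of_isWeaklyRegular ss hss 0 ?_ M hreg.toIsWeaklyRegular _ (by omega)
    rwa [hl, zero_add]
  · have hfin : Module.Finite R (ModuleCat.of R M) := ‹Module.Finite R M›
    have hfin' : Module.Finite R (ModuleCat.of R (R ⧸ IsLocalRing.maximalIdeal R)) :=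
      inferInstanceAs (Module.Finite R (R ⧸ IsLocalRing.maximalIdeal R))
    exact ModuleCat.exists_isRegular_of_exists_subsingleton_ext (IsLocalRing.maximalIdeal R)
      rs.length (ModuleCat.of R M) (maximalIdeal_smul_top_lt M)
      (ModuleCat.of R (R ⧸ IsLocalRing.maximalIdeal R)) (support_quotient_eq _)
      fun i hi => h.subsingleton_ext_residue hE hm hrs.toIsWeaklyRegular i hi M

end MCM

end GrothMod

namespace GrothMod

/-! ### Syzygies and cosyzygies of maximal Cohen–Macaulay modules without free summand -/

section ReducedAcyclic

variable {R : Type u} [CommRing R] [IsLocalRing R]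

/-- `M` has no non-zero free direct summand and `Ext^i(M, R) = 0` for all `i > 0`. Over a
Gorenstein ring the finitely generated such modules are zero or the maximal Cohen–Macaulay modules
without free summand. -/
structure ReducedAcyclic (R : Type u) [CommRing R] [IsLocalRing R] (M : Type u) [AddCommGroup M]
    [Module R M] : Prop where
  dualAcyclic : DualAcyclic R M
  noFreeSummand : NoFreeSummand R M

section

variable {M N : Type u} [AddCommGroup M] [Module R M] [AddCommGroup N] [Module R N]

theorem ReducedAcyclic.of_retract (hN : ReducedAcyclic R N) (s : M →ₗ[R] N) (r : N →ₗ[R] M)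
    (hrs : r ∘ₗ s = LinearMap.id) : ReducedAcyclic R M :=
  ⟨hN.dualAcyclic.of_retract s r hrs, hN.noFreeSummand.of_surjective r
    fun x => ⟨s x, LinearMap.congr_fun hrs x⟩⟩

theorem ReducedAcyclic.congr (hN : ReducedAcyclic R N) (e : M ≃ₗ[R] N) : ReducedAcyclic R M :=
  hN.of_retract e.toLinearMap e.symm.toLinearMap (by ext; simp)

theorem ReducedAcyclic.prod (hM : ReducedAcyclic R M) (hN : ReducedAcyclic R N) :
    ReducedAcyclic R (M × N) :=
  ⟨hM.dualAcyclic.prod hN.dualAcyclic, hM.noFreeSummand.prod hN.noFreeSummand⟩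

theorem ReducedAcyclic.left_of_equiv_prod {L : Type u} [AddCommGroup L] [Module R L]
    (hL : ReducedAcyclic R L) (e : L ≃ₗ[R] M × N) : ReducedAcyclic R M :=
  (hL.congr e.symm).of_retract (LinearMap.inl R M N) (LinearMap.fst R M N) (by ext; simp)

theorem ReducedAcyclic.right_of_equiv_prod {L : Type u} [AddCommGroup L] [Module R L]
    (hL : ReducedAcyclic R L) (e : L ≃ₗ[R] M × N) : ReducedAcyclic R N :=
  (hL.congr e.symm).of_retract (LinearMap.inr R M N) (LinearMap.snd R M N) (by ext; simp)

theorem ReducedAcyclic.component {I : Type} {N : I → Type u}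
    [∀ i, AddCommGroup (N i)] [∀ i, Module R (N i)] (hM : ReducedAcyclic R M)
    (e : M ≃ₗ[R] (∀ i, N i)) (i : I) : ReducedAcyclic R (N i) := by
  classical
  exact (hM.congr e.symm).of_retract (LinearMap.single R N i) (LinearMap.proj i) (by ext; simp)

theorem IsMinimalSyzygy.reducedAcyclic (h : IsMinimalSyzygy R M N) (hN : DualAcyclic R N) :
    ReducedAcyclic R M :=
  ⟨h.dualAcyclic hN, h.noFreeSummand (hN 0)⟩

/-- Among modules without free summand and with `Ext^i(M, R) = 0` for `i > 0`, a module is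
determined by its minimal syzygy. -/
theorem ReducedAcyclic.nonempty_equiv {K K' : Type u} [AddCommGroup K] [Module R K]
    [AddCommGroup K'] [Module R K'] (hM : ReducedAcyclic R M) (hN : ReducedAcyclic R N)
    (h : IsMinimalSyzygy R K M) (h' : IsMinimalSyzygy R K' N) (e : K ≃ₗ[R] K') :
    Nonempty (M ≃ₗ[R] N) :=
  h.nonempty_equiv_of_extVanishes h' e (hM.dualAcyclic 0) (hN.dualAcyclic 0) hM.noFreeSummand
    hN.noFreeSummand

theorem ReducedAcyclic.subsingleton_of_syzygy (hN : ReducedAcyclic R N)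
    (h : IsMinimalSyzygy R M N) (hM : Subsingleton M) : Subsingleton N :=
  have := h.free_of_subsingleton
  hN.noFreeSummand.subsingleton_of_free

end

variable [IsNoetherianRing R]

theorem isMinimalSyzygy_syzygy (M : FGModuleCat.{u} R) : IsMinimalSyzygy R (syzygy M) M :=
  (exists_isFreeCover (R := R) M).choose_spec.choose_spec.isMinimalSyzygy

theorem reducedAcyclic_syzygy {M : FGModuleCat.{u} R} (hM : DualAcyclic R M) :
    ReducedAcyclic R (syzygy M) :=
  (isMinimalSyzygy_syzygy M).reducedAcyclic hM

theorem ReducedAcyclic.cosyzygy {d : ℕ} (hR : ExtVanishesAbove R d) {M : FGModuleCat.{u} R}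
    (hM : ReducedAcyclic R M) : ReducedAcyclic R (cosyzygy M) :=
  have h := (exists_isFreeEnvelope (R := R) M).choose_spec.choose_spec
  ⟨hM.dualAcyclic.quotient_range (h.injective hR hM.dualAcyclic) h.exists_extension,
    h.noFreeSummand⟩

theorem ReducedAcyclic.isMinimalSyzygy_cosyzygy {d : ℕ} (hR : ExtVanishesAbove R d)
    {M : FGModuleCat.{u} R} (hM : ReducedAcyclic R M) :
    IsMinimalSyzygy R M (GrothMod.cosyzygy M) :=
  hM.noFreeSummand.isMinimalSyzygy
    ((exists_isFreeEnvelope (R := R) M).choose_spec.choose_spec.injective hR hM.dualAcyclic)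

theorem nonempty_syzygy_congr {M N : FGModuleCat.{u} R} (e : M ≃ₗ[R] N) :
    Nonempty (syzygy M ≃ₗ[R] syzygy N) :=
  (isMinimalSyzygy_syzygy M).nonempty_equiv (isMinimalSyzygy_syzygy N) e

theorem nonempty_syzygy_iterate_congr {M N : FGModuleCat.{u} R} (e : M ≃ₗ[R] N) (n : ℕ) :
    Nonempty (syzygy^[n] M ≃ₗ[R] syzygy^[n] N) := by
  induction n with
  | zero => exact ⟨e⟩
  | succ n ih =>
    obtain ⟨e'⟩ := ih
    rw [Function.iterate_succ_apply', Function.iterate_succ_apply']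
    exact nonempty_syzygy_congr e'

theorem nonempty_syzygy_iterate_prod (M N : FGModuleCat.{u} R) (n : ℕ) :
    Nonempty (syzygy^[n] (FGModuleCat.of R (M × N)) ≃ₗ[R] (syzygy^[n] M × syzygy^[n] N)) := by
  induction n with
  | zero => exact ⟨LinearEquiv.refl R _⟩
  | succ n ih =>
    obtain ⟨e⟩ := ih
    rw [Function.iterate_succ_apply', Function.iterate_succ_apply', Function.iterate_succ_apply']
    exact (isMinimalSyzygy_syzygy _).nonempty_equiv
      ((isMinimalSyzygy_syzygy _).prod (isMinimalSyzygy_syzygy _)) e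

theorem ReducedAcyclic.nonempty_cosyzygy_congr {d : ℕ} (hR : ExtVanishesAbove R d)
    {M N : FGModuleCat.{u} R} (hN : ReducedAcyclic R N) (e : M ≃ₗ[R] N) :
    Nonempty (GrothMod.cosyzygy M ≃ₗ[R] GrothMod.cosyzygy N) :=
  have hM := hN.congr e
  (hM.cosyzygy hR).nonempty_equiv (hN.cosyzygy hR) (hM.isMinimalSyzygy_cosyzygy hR)
    (hN.isMinimalSyzygy_cosyzygy hR) e

theorem ReducedAcyclic.nonempty_syzygy_cosyzygy {d : ℕ} (hR : ExtVanishesAbove R d)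
    {M : FGModuleCat.{u} R} (hM : ReducedAcyclic R M) :
    Nonempty (syzygy (GrothMod.cosyzygy M) ≃ₗ[R] M) :=
  (isMinimalSyzygy_syzygy _).nonempty_equiv (hM.isMinimalSyzygy_cosyzygy hR) (LinearEquiv.refl R _)

theorem ReducedAcyclic.nonempty_cosyzygy_syzygy {d : ℕ} (hR : ExtVanishesAbove R d)
    {M : FGModuleCat.{u} R} (hM : ReducedAcyclic R M) :
    Nonempty (GrothMod.cosyzygy (syzygy M) ≃ₗ[R] M) :=
  have h := reducedAcyclic_syzygy hM.dualAcyclic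
  (h.cosyzygy hR).nonempty_equiv hM (h.isMinimalSyzygy_cosyzygy hR) (isMinimalSyzygy_syzygy M)
    (LinearEquiv.refl R _)

theorem ReducedAcyclic.syzygy_iterate {M : FGModuleCat.{u} R} (hM : ReducedAcyclic R M) (n : ℕ) :
    ReducedAcyclic R (syzygy^[n] M : FGModuleCat.{u} R) := by
  induction n with
  | zero => exact hM
  | succ n ih =>
    rw [Function.iterate_succ_apply']
    exact reducedAcyclic_syzygy ih.dualAcyclic

theorem ReducedAcyclic.cosyzygy_iterate {d : ℕ} (hR : ExtVanishesAbove R d)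
    {M : FGModuleCat.{u} R} (hM : ReducedAcyclic R M) (n : ℕ) :
    ReducedAcyclic R (GrothMod.cosyzygy^[n] M : FGModuleCat.{u} R) := by
  induction n with
  | zero => exact hM
  | succ n ih =>
    rw [Function.iterate_succ_apply']
    exact ih.cosyzygy hR

/-- The `d`-th syzygy has vanishing `Ext^i(-, R)` for `i > 0`; one more syzygy removes the free
summands. -/
theorem reducedAcyclic_syzygy_iterate {d : ℕ} (hR : ExtVanishesAbove R d)
    (M : FGModuleCat.{u} R) :
    ReducedAcyclic R (syzygy^[d + 1] M : FGModuleCat.{u} R) := by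
  have h : ∀ (n i : ℕ), d < n + (i + 1) →
      ExtVanishes R (syzygy^[n] M : FGModuleCat.{u} R) (i + 1) := by
    intro n
    induction n with
    | zero => exact fun i hi => hR _ _ (by omega)
    | succ n ih =>
      intro i hi
      rw [Function.iterate_succ_apply']
      exact (isMinimalSyzygy_syzygy _).extVanishes (ih (i + 1) (by omega))
  rw [Function.iterate_succ_apply']
  exact reducedAcyclic_syzygy fun i => h d i (by omega)

end ReducedAcyclic

/-! ### Indecomposable modules -/

section Indecomposable

variable {R : Type u} [CommRing R]

theorem IsIndecomposable.subsingleton_or_subsingleton {M A B : Type u} [AddCommGroup M]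
    [Module R M] [AddCommGroup A] [Module R A] [AddCommGroup B] [Module R B]
    (hM : IsIndecomposable R M) (e : M ≃ₗ[R] A × B) : Subsingleton A ∨ Subsingleton B := by
  have hc : IsCompl (LinearMap.ker (LinearMap.snd R A B ∘ₗ e.toLinearMap))
      (LinearMap.ker (LinearMap.fst R A B ∘ₗ e.toLinearMap)) := by
    constructor
    · rw [Submodule.disjoint_def]
      intro x hx hx'
      exact e.map_eq_zero_iff.1 (Prod.ext hx' hx)
    · rw [codisjoint_iff_le_sup]
      intro x _
      have : x = e.symm ((e x).1, 0) + e.symm (0, (e x).2) := by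
        rw [← map_add]; simp
      rw [this]
      exact Submodule.add_mem_sup (by simp) (by simp)
  refine (hM.2 _ _ hc).imp (fun h => ?_) (fun h => ?_)
  · refine subsingleton_of_forall_eq 0 fun a => ?_
    have : e.symm (a, 0) ∈ LinearMap.ker (LinearMap.snd R A B ∘ₗ e.toLinearMap) := by simp
    rw [h, Submodule.mem_bot, LinearEquiv.map_eq_zero_iff] at this
    exact congrArg Prod.fst this
  · refine subsingleton_of_forall_eq 0 fun b => ?_
    have : e.symm (0, b) ∈ LinearMap.ker (LinearMap.fst R A B ∘ₗ e.toLinearMap) := by simp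
    rw [h, Submodule.mem_bot, LinearEquiv.map_eq_zero_iff] at this
    exact congrArg Prod.snd this

theorem isIndecomposable_of_forall_prod {M : Type u} [AddCommGroup M] [Module R M] [Nontrivial M]
    (h : ∀ p q : Submodule R M, (M ≃ₗ[R] p × q) → Subsingleton p ∨ Subsingleton q) :
    IsIndecomposable R M :=
  ⟨inferInstance, fun p q hpq => (h p q (Submodule.prodEquivOfIsCompl p q hpq).symm).imp
    Submodule.subsingleton_iff_eq_bot.1 Submodule.subsingleton_iff_eq_bot.1⟩

theorem IsIndecomposable.congr {M N : Type u} [AddCommGroup M] [Module R M] [AddCommGroup N]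
    [Module R N] (hN : IsIndecomposable R N) (e : M ≃ₗ[R] N) : IsIndecomposable R M :=
  have := hN.1
  have := e.toEquiv.nontrivial
  isIndecomposable_of_forall_prod fun _ _ e' => hN.subsingleton_or_subsingleton (e.symm.trans e')

/-- Every quotient of a Noetherian module is a finite direct sum of indecomposable modules, by
Noetherian induction on the kernel: a decomposable quotient is a sum of two smaller ones. -/
theorem exists_pi_equiv_quotient [IsNoetherianRing R] (M : Type u) [AddCommGroup M] [Module R M]
    [Module.Finite R M] (P : Submodule R M) :
    ∃ (I : Type) (_ : Fintype I) (N : I → FGModuleCat.{u} R), (∀ i, IsIndecomposable R (N i)) ∧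
      Nonempty ((M ⧸ P) ≃ₗ[R] (∀ i, N i)) := by
  induction P using WellFoundedGT.induction with
  | ind P ih =>
  obtain hs | hn := subsingleton_or_nontrivial (M ⧸ P)
  · exact ⟨Empty, inferInstance, Empty.elim, fun i => i.elim, ⟨0, 0, fun _ => Subsingleton.elim _ _,
      fun _ => Subsingleton.elim _ _⟩⟩
  by_cases hi : IsIndecomposable R (M ⧸ P)
  · exact ⟨Unit, inferInstance, fun _ => FGModuleCat.of R (M ⧸ P), fun _ => hi,
      ⟨(LinearEquiv.funUnique Unit R (M ⧸ P)).symm⟩⟩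
  · obtain ⟨p, q, hpq, hp, hq⟩ : ∃ p q : Submodule R (M ⧸ P), IsCompl p q ∧ p ≠ ⊥ ∧ q ≠ ⊥ := by
      by_contra! hno
      exact hi ⟨hn, fun p q hpq => or_iff_not_imp_left.2 (hno p q hpq)⟩
    have hstep : ∀ r : Submodule R (M ⧸ P), r ≠ ⊥ →
        ∃ (I : Type) (_ : Fintype I) (N : I → FGModuleCat.{u} R),
          (∀ i, IsIndecomposable R (N i)) ∧ Nonempty (((M ⧸ P) ⧸ r) ≃ₗ[R] (∀ i, N i)) := by
      intro r hr
      have hle : P ≤ r.comap P.mkQ := by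
        conv_lhs => rw [← P.ker_mkQ]
        exact LinearMap.ker_le_comap _
      have hlt : P < r.comap P.mkQ := by
        refine lt_of_le_of_ne hle fun h => hr ?_
        rw [← Submodule.map_comap_eq_of_surjective P.mkQ_surjective r, ← h, Submodule.mkQ_map_self]
      obtain ⟨I, hI, N, hN, ⟨e⟩⟩ := ih _ hlt
      have e' := Submodule.quotientQuotientEquivQuotient P _ hle
      rw [Submodule.map_comap_eq_of_surjective P.mkQ_surjective] at e'
      exact ⟨I, hI, N, hN, ⟨e'.trans e⟩⟩
    obtain ⟨I, hI, N, hN, ⟨e⟩⟩ := hstep q hq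
    obtain ⟨I', hI', N', hN', ⟨e'⟩⟩ := hstep p hp
    refine ⟨I ⊕ I', inferInstance, Sum.elim N N', fun i => ?_, ⟨?_⟩⟩
    · cases i with
      | inl i => exact hN i
      | inr i => exact hN' i
    · exact (Submodule.prodEquivOfIsCompl p q hpq).symm.trans
        ((((Submodule.quotientEquivOfIsCompl q p hpq.symm).symm.trans e).prodCongr
          ((Submodule.quotientEquivOfIsCompl p q hpq).symm.trans e')).trans
          (LinearEquiv.sumPiEquivProdPi R I I' fun i => (Sum.elim N N' i : FGModuleCat.{u} R)).symm)

/-- A finitely generated module over a Noetherian ring is a finite direct sum of indecomposable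
modules. -/
theorem exists_indecomposable_decomposition [IsNoetherianRing R] (M : FGModuleCat.{u} R) :
    ∃ (n : ℕ) (N : Fin n → FGModuleCat.{u} R), (∀ i, IsIndecomposable R (N i)) ∧
      Nonempty (M ≃ₗ[R] (∀ i, N i)) := by
  obtain ⟨I, hI, N, hN, ⟨e⟩⟩ := exists_pi_equiv_quotient (R := R) M ⊥
  exact ⟨_, fun j => N ((Fintype.equivFin I).symm j), fun j => hN _,
    ⟨((Submodule.quotEquivOfEqBot ⊥ rfl).symm.trans e).trans
      (LinearEquiv.piCongrLeft' R (fun i => N i) (Fintype.equivFin I))⟩⟩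

variable [IsLocalRing R]

theorem IsIndecomposable.noFreeSummand {M : Type u} [AddCommGroup M] [Module R M]
    (hM : IsIndecomposable R M) (hfree : ¬ Module.Free R M) : NoFreeSummand R M := by
  intro f x
  by_contra hunit
  rw [IsLocalRing.mem_maximalIdeal, mem_nonunits_iff, not_not] at hunit
  obtain ⟨v, hv⟩ := hunit
  have hsurj : Function.Surjective f := fun r => ⟨(r * ↑v⁻¹ : R) • x, by
    rw [map_smul, ← hv, smul_eq_mul, mul_assoc, Units.inv_mul, mul_one]⟩
  obtain ⟨e⟩ := nonempty_prod_of_exact (Submodule.injective_subtype _)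
    (LinearMap.exact_subtype_ker_map f) hsurj
  obtain h | h := hM.subsingleton_or_subsingleton e
  · have hinj : Function.Injective f :=
      LinearMap.ker_eq_bot.1 (Submodule.subsingleton_iff_eq_bot.1 h)
    exact hfree (Module.Free.of_equiv (LinearEquiv.ofBijective f ⟨hinj, hsurj⟩).symm)
  · exact zero_ne_one (Subsingleton.elim (0 : R) 1)

variable [IsNoetherianRing R]

/-- The syzygy of an indecomposable maximal Cohen–Macaulay module without free summand is
indecomposable: the cosyzygies of its summands sum up to the module. -/
theorem ReducedAcyclic.isIndecomposable_syzygy {d : ℕ} (hR : ExtVanishesAbove R d)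
    {M : FGModuleCat.{u} R} (hM : ReducedAcyclic R M) (hi : IsIndecomposable R M) :
    IsIndecomposable R (syzygy M) := by
  have hs := isMinimalSyzygy_syzygy M
  have hK := reducedAcyclic_syzygy hM.dualAcyclic
  obtain hsub | hnon := subsingleton_or_nontrivial (syzygy M)
  · have h1 := hM.subsingleton_of_syzygy hs hsub
    exact absurd hi.1 (not_nontrivial_iff_subsingleton.2 h1)
  · refine isIndecomposable_of_forall_prod fun p q e => ?_
    have hp : ReducedAcyclic R (FGModuleCat.of R p) := hK.left_of_equiv_prod e
    have hq : ReducedAcyclic R (FGModuleCat.of R q) := hK.right_of_equiv_prod e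
    have hp' := hp.isMinimalSyzygy_cosyzygy hR
    have hq' := hq.isMinimalSyzygy_cosyzygy hR
    obtain ⟨e'⟩ := hM.nonempty_equiv ((hp.cosyzygy hR).prod (hq.cosyzygy hR)) hs
      (hp'.prod hq') e
    exact (hi.subsingleton_or_subsingleton e').imp (hp'.subsingleton_of_subsingleton)
      (hq'.subsingleton_of_subsingleton)

theorem ReducedAcyclic.isIndecomposable_cosyzygy {d : ℕ} (hR : ExtVanishesAbove R d)
    {M : FGModuleCat.{u} R} (hM : ReducedAcyclic R M) (hi : IsIndecomposable R M) :
    IsIndecomposable R (GrothMod.cosyzygy M) := by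
  have hs := hM.isMinimalSyzygy_cosyzygy hR
  have hC := hM.cosyzygy hR
  obtain hsub | hnon := subsingleton_or_nontrivial (GrothMod.cosyzygy M)
  · have h1 := hs.subsingleton_of_subsingleton hsub
    exact absurd hi.1 (not_nontrivial_iff_subsingleton.2 h1)
  · refine isIndecomposable_of_forall_prod fun p q e => ?_
    have hp : ReducedAcyclic R (FGModuleCat.of R p) := hC.left_of_equiv_prod e
    have hq : ReducedAcyclic R (FGModuleCat.of R q) := hC.right_of_equiv_prod e
    have hp' := isMinimalSyzygy_syzygy (FGModuleCat.of R p)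
    have hq' := isMinimalSyzygy_syzygy (FGModuleCat.of R q)
    obtain ⟨e'⟩ := hs.nonempty_equiv (hp'.prod hq') e
    exact (hi.subsingleton_or_subsingleton e').imp (hp.subsingleton_of_syzygy hp')
      (hq.subsingleton_of_syzygy hq')

end Indecomposable

end GrothMod

namespace GrothMod

/-! ### The permutation of the classes of indecomposable maximal Cohen–Macaulay modules -/

section Perm

variable {R : Type u} [CommRing R]

theorem isoClass_eq_iff {M N : FGModuleCat.{u} R} :
    isoClass M = isoClass N ↔ Nonempty (M ≃ₗ[R] N) :=
  Quotient.eq (r := isoSetoid R)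

theorem isoClass_out (x : IsoClass R) : isoClass (Quotient.out x) = x :=
  Quotient.out_eq x

variable [IsLocalRing R] [IsNoetherianRing R]

theorem isoClass_mem_mcmClasses_iff (hG : IsGorenstein R) {d : ℕ} (hd : ringKrullDim R = d)
    {M : FGModuleCat.{u} R} :
    isoClass M ∈ mcmClasses R ↔ IsIndecomposable R M ∧ ReducedAcyclic R M := by
  constructor
  · rintro ⟨N, ⟨hN, hf, hi⟩, h⟩
    obtain ⟨e⟩ := isoClass_eq_iff.1 h
    have hN' := ((isMCM_iff_dualAcyclic hG hd N).1 hN).2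
    exact ⟨hi.congr e.symm, ReducedAcyclic.congr ⟨hN', hi.noFreeSummand hf⟩ e.symm⟩
  · rintro ⟨hi, hr⟩
    have hn := hi.1
    refine ⟨M, ⟨(isMCM_iff_dualAcyclic hG hd M).2 ⟨hn, hr.dualAcyclic⟩, fun hf => ?_, hi⟩, rfl⟩
    exact not_subsingleton_iff_nontrivial.2 hn hr.noFreeSummand.subsingleton_of_free

/-- The permutation of the classes of indecomposable non-free maximal Cohen–Macaulay modules
induced by the cosyzygy; its inverse is induced by the syzygy. -/
noncomputable def cosyzygyPerm (hG : IsGorenstein R) {d : ℕ} (hd : ringKrullDim R = d) :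
    Equiv.Perm (mcmClasses R) :=
  have hR := (hG.extVanishesAbove_and_exists_isRegular hd).1
  have hmem : ∀ x : mcmClasses R, IsIndecomposable R (Quotient.out x.1 : FGModuleCat.{u} R) ∧
      ReducedAcyclic R (Quotient.out x.1 : FGModuleCat.{u} R) := fun x =>
    (isoClass_mem_mcmClasses_iff hG hd).1 (by rw [isoClass_out]; exact x.2)
  { toFun := fun x => ⟨isoClass (cosyzygy (Quotient.out x.1)),
      (isoClass_mem_mcmClasses_iff hG hd).2
        ⟨(hmem x).2.isIndecomposable_cosyzygy hR (hmem x).1, (hmem x).2.cosyzygy hR⟩⟩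
    invFun := fun x => ⟨isoClass (syzygy (Quotient.out x.1)),
      (isoClass_mem_mcmClasses_iff hG hd).2
        ⟨(hmem x).2.isIndecomposable_syzygy hR (hmem x).1,
          reducedAcyclic_syzygy (hmem x).2.dualAcyclic⟩⟩
    left_inv := fun x => Subtype.ext (by
      obtain ⟨e⟩ := isoClass_eq_iff.1 (isoClass_out (isoClass (cosyzygy (Quotient.out x.1))))
      obtain ⟨e'⟩ := nonempty_syzygy_congr e
      obtain ⟨e''⟩ := (hmem x).2.nonempty_syzygy_cosyzygy hR
      exact (isoClass_eq_iff.2 ⟨e'.trans e''⟩).trans (isoClass_out x.1))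
    right_inv := fun x => Subtype.ext (by
      obtain ⟨e⟩ := isoClass_eq_iff.1 (isoClass_out (isoClass (syzygy (Quotient.out x.1))))
      obtain ⟨e'⟩ := (reducedAcyclic_syzygy (hmem x).2.dualAcyclic).nonempty_cosyzygy_congr hR e
      obtain ⟨e''⟩ := (hmem x).2.nonempty_cosyzygy_syzygy hR
      exact (isoClass_eq_iff.2 ⟨e'.trans e''⟩).trans (isoClass_out x.1)) }

theorem isoClass_cosyzygy_eq (hG : IsGorenstein R) {d : ℕ} (hd : ringKrullDim R = d)
    (x : mcmClasses R) (M : FGModuleCat.{u} R) (h : isoClass M = x.1) :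
    isoClass (cosyzygy M) = (cosyzygyPerm hG hd x).1 := by
  have hx := (isoClass_mem_mcmClasses_iff hG hd (M := (Quotient.out x.1 : FGModuleCat.{u} R))).1
    (by rw [isoClass_out]; exact x.2)
  obtain ⟨e⟩ := isoClass_eq_iff.1 (h.trans (isoClass_out x.1).symm)
  exact isoClass_eq_iff.2
    (hx.2.nonempty_cosyzygy_congr (hG.extVanishesAbove_and_exists_isRegular hd).1 e)

theorem isoClass_syzygy_eq (hG : IsGorenstein R) {d : ℕ} (hd : ringKrullDim R = d)
    (x : mcmClasses R) (M : FGModuleCat.{u} R) (h : isoClass M = x.1) :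
    isoClass (syzygy M) = ((cosyzygyPerm hG hd).symm x).1 := by
  obtain ⟨e⟩ := isoClass_eq_iff.1 (h.trans (isoClass_out x.1).symm)
  exact isoClass_eq_iff.2 (nonempty_syzygy_congr e)

end Perm

/-! ### The class of a module in the free group on indecomposable classes -/

section MCMPart

variable {R : Type u} [CommRing R] [IsLocalRing R] [IsNoetherianRing R]

open Classical in
/-- The basis element of an isomorphism class of non-free indecomposable maximal Cohen–Macaulay
modules, and `0` for the other isomorphism classes. -/
noncomputable def mcmIndicator (x : IsoClass R) : mcmClasses R →₀ ℤ :=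
  if h : x ∈ mcmClasses R then Finsupp.single ⟨x, h⟩ 1 else 0

omit [IsNoetherianRing R] in
theorem mcmIndicator_of_mem {x : IsoClass R} (h : x ∈ mcmClasses R) :
    mcmIndicator x = Finsupp.single ⟨x, h⟩ 1 :=
  dif_pos h

/-- The sum of the classes of the non-free maximal Cohen–Macaulay modules in a chosen
decomposition of `M` into indecomposable modules. By the Krull–Remak–Schmidt property it does not
depend on the decomposition. -/
noncomputable def mcmPart (M : FGModuleCat.{u} R) : mcmClasses R →₀ ℤ :=
  ∑ i, mcmIndicator
    (isoClass ((exists_indecomposable_decomposition M).choose_spec.choose i))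

theorem mcmPart_eq (hK : KrullRemakSchmidt R) {M : FGModuleCat.{u} R} {I : Type} [Fintype I]
    {N : I → FGModuleCat.{u} R} (hN : ∀ i, IsIndecomposable R (N i)) (e : M ≃ₗ[R] (∀ i, N i)) :
    mcmPart M = ∑ i, mcmIndicator (isoClass (N i)) := by
  obtain ⟨hL, ⟨e'⟩⟩ := (exists_indecomposable_decomposition M).choose_spec.choose_spec
  let c := Fintype.equivFin I
  obtain ⟨f, hf⟩ := hK _ _ _ (fun j => N (c.symm j)) hL (fun j => hN _)
    ⟨(e'.symm.trans e).trans (LinearEquiv.piCongrLeft' R (fun i => N i) c)⟩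
  exact Fintype.sum_equiv (f.trans c.symm) _ _ fun i => congrArg mcmIndicator
    (isoClass_eq_iff.2 (hf i))

theorem mcmPart_congr (hK : KrullRemakSchmidt R) {M M' : FGModuleCat.{u} R} (e : M ≃ₗ[R] M') :
    mcmPart M = mcmPart M' := by
  obtain ⟨n, N, hN, ⟨e'⟩⟩ := exists_indecomposable_decomposition M'
  rw [mcmPart_eq hK hN e', mcmPart_eq hK hN (e.trans e')]

theorem mcmPart_eq_add (hK : KrullRemakSchmidt R) {L M M' : FGModuleCat.{u} R}
    (e : L ≃ₗ[R] M × M') : mcmPart L = mcmPart M + mcmPart M' := by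
  obtain ⟨n, N, hN, ⟨f⟩⟩ := exists_indecomposable_decomposition M
  obtain ⟨n', N', hN', ⟨f'⟩⟩ := exists_indecomposable_decomposition M'
  rw [mcmPart_eq hK hN f, mcmPart_eq hK hN' f',
    mcmPart_eq hK (N := Sum.elim N N') (M := L) ?_
      ((e.trans (f.prodCongr f')).trans (LinearEquiv.sumPiEquivProdPi R (Fin n) (Fin n')
        fun i => (Sum.elim N N' i : FGModuleCat.{u} R)).symm), Fintype.sum_sum_type]
  · rfl
  · rintro (i | i)
    · exact hN i
    · exact hN' i

theorem mem_mcmClasses_of_decomposition (hG : IsGorenstein R) {d : ℕ} (hd : ringKrullDim R = d)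
    {M : FGModuleCat.{u} R} (hM : ReducedAcyclic R M) {I : Type}
    {N : I → FGModuleCat.{u} R} (hN : ∀ i, IsIndecomposable R (N i)) (e : M ≃ₗ[R] (∀ i, N i))
    (i : I) : isoClass (N i) ∈ mcmClasses R :=
  (isoClass_mem_mcmClasses_iff hG hd).2 ⟨hN i, hM.component e i⟩

theorem mcmPart_eq_sum_single (hG : IsGorenstein R) (hK : KrullRemakSchmidt R) {d : ℕ}
    (hd : ringKrullDim R = d) {M : FGModuleCat.{u} R} (hM : ReducedAcyclic R M) {I : Type}
    [Fintype I] {N : I → FGModuleCat.{u} R} (hN : ∀ i, IsIndecomposable R (N i))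
    (e : M ≃ₗ[R] (∀ i, N i)) :
    mcmPart M = ∑ i, Finsupp.single
      ⟨isoClass (N i), mem_mcmClasses_of_decomposition hG hd hM hN e i⟩ 1 := by
  rw [mcmPart_eq hK hN e]
  exact Finset.sum_congr rfl fun i _ => mcmIndicator_of_mem _

/-- `mcmPart M`, seen in the `ℤ[t, t⁻¹]`-module on which `t` acts by the cosyzygy. -/
noncomputable abbrev permMcmPart (hG : IsGorenstein R) {d : ℕ} (hd : ringKrullDim R = d)
    (M : FGModuleCat.{u} R) : PermModule (cosyzygyPerm hG hd) :=
  toPermModule _ (mcmPart M)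

/-- The syzygy acts as `t⁻¹`: the minimal syzygy of a direct sum of indecomposable modules is the
direct sum of their syzygies, which are again indecomposable. -/
theorem permMcmPart_syzygy (hG : IsGorenstein R) (hK : KrullRemakSchmidt R) {d : ℕ}
    (hd : ringKrullDim R = d) {M : FGModuleCat.{u} R} (hM : ReducedAcyclic R M) :
    permMcmPart hG hd (syzygy M) =
      (LaurentPolynomial.T (-1) : ℤ[T;T⁻¹]) • permMcmPart hG hd M := by
  have hR := (hG.extVanishesAbove_and_exists_isRegular hd).1
  obtain ⟨n, N, hN, ⟨e⟩⟩ := exists_indecomposable_decomposition M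
  obtain ⟨e'⟩ := (isMinimalSyzygy_syzygy M).nonempty_equiv
    (IsMinimalSyzygy.pi fun i => isMinimalSyzygy_syzygy (N i)) e
  rw [permMcmPart, permMcmPart, mcmPart_eq_sum_single hG hK hd hM hN e,
    mcmPart_eq_sum_single hG hK hd (reducedAcyclic_syzygy hM.dualAcyclic)
      (fun i => (hM.component e i).isIndecomposable_syzygy hR (hN i)) e',
    map_sum, map_sum, Finset.smul_sum]
  refine Finset.sum_congr rfl fun i _ => ?_
  rw [T_smul_single]
  congr 2
  exact Subtype.ext (isoClass_syzygy_eq hG hd ⟨isoClass (N i), _⟩ (N i) rfl)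

theorem permMcmPart_syzygy_iterate (hG : IsGorenstein R) (hK : KrullRemakSchmidt R) {d : ℕ}
    (hd : ringKrullDim R = d) {M : FGModuleCat.{u} R} (hM : ReducedAcyclic R M) (n : ℕ) :
    (LaurentPolynomial.T n : ℤ[T;T⁻¹]) • permMcmPart hG hd (syzygy^[n] M) =
      permMcmPart hG hd M := by
  induction n with
  | zero => simp
  | succ n ih =>
    rw [Function.iterate_succ_apply', permMcmPart_syzygy hG hK hd (hM.syzygy_iterate n),
      smul_smul, ← LaurentPolynomial.T_add]
    simpa using ih

theorem permMcmPart_cosyzygy (hG : IsGorenstein R) (hK : KrullRemakSchmidt R) {d : ℕ}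
    (hd : ringKrullDim R = d) {M : FGModuleCat.{u} R} (hM : ReducedAcyclic R M) :
    permMcmPart hG hd (cosyzygy M) =
      (LaurentPolynomial.T 1 : ℤ[T;T⁻¹]) • permMcmPart hG hd M := by
  have hR := (hG.extVanishesAbove_and_exists_isRegular hd).1
  have h := permMcmPart_syzygy hG hK hd (hM.cosyzygy hR)
  obtain ⟨e⟩ := hM.nonempty_syzygy_cosyzygy hR
  rw [permMcmPart, mcmPart_congr hK e] at h
  have h' : permMcmPart hG hd M =
    (LaurentPolynomial.T (-1) : ℤ[T;T⁻¹]) • permMcmPart hG hd (cosyzygy M) := h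
  rw [h', smul_smul, ← LaurentPolynomial.T_add]
  simp

theorem permMcmPart_cosyzygy_iterate (hG : IsGorenstein R) (hK : KrullRemakSchmidt R) {d : ℕ}
    (hd : ringKrullDim R = d) {M : FGModuleCat.{u} R} (hM : ReducedAcyclic R M) (n : ℕ) :
    permMcmPart hG hd (cosyzygy^[n] M) =
      (LaurentPolynomial.T n : ℤ[T;T⁻¹]) • permMcmPart hG hd M := by
  have hR := (hG.extVanishesAbove_and_exists_isRegular hd).1
  induction n with
  | zero => simp
  | succ n ih =>
    rw [Function.iterate_succ_apply', permMcmPart_cosyzygy hG hK hd (hM.cosyzygy_iterate hR n),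
      ih, smul_smul, ← LaurentPolynomial.T_add, add_comm, Nat.cast_succ]

end MCMPart

/-! ### The inverse of the canonical map -/

section StableClass

variable {R : Type u} [CommRing R] [IsLocalRing R] [IsNoetherianRing R]

/-- The element `t^{d+1} [Ω^{d+1} M]`, which is the value of the inverse of the canonical map on
the class of `M`. -/
noncomputable def stableClass (hG : IsGorenstein R) {d : ℕ} (hd : ringKrullDim R = d)
    (M : FGModuleCat.{u} R) : PermModule (cosyzygyPerm hG hd) :=
  (LaurentPolynomial.T ((d + 1 : ℕ) : ℤ) : ℤ[T;T⁻¹]) • permMcmPart hG hd (syzygy^[d + 1] M)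

variable (hG : IsGorenstein R) (hK : KrullRemakSchmidt R) {d : ℕ} (hd : ringKrullDim R = d)

include hK

theorem stableClass_congr {M N : FGModuleCat.{u} R} (e : M ≃ₗ[R] N) :
    stableClass hG hd M = stableClass hG hd N := by
  obtain ⟨e'⟩ := nonempty_syzygy_iterate_congr e (d + 1)
  rw [stableClass, stableClass, permMcmPart, mcmPart_congr hK e']

theorem stableClass_prod (M N : FGModuleCat.{u} R) :
    stableClass hG hd (FGModuleCat.of R (M × N)) = stableClass hG hd M + stableClass hG hd N := by
  obtain ⟨e⟩ := nonempty_syzygy_iterate_prod M N (d + 1)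
  rw [stableClass, stableClass, stableClass, permMcmPart, mcmPart_eq_add hK e, map_add, smul_add]

theorem stableClass_of_reducedAcyclic {M : FGModuleCat.{u} R} (hM : ReducedAcyclic R M) :
    stableClass hG hd M = permMcmPart hG hd M :=
  permMcmPart_syzygy_iterate hG hK hd hM (d + 1)

/-- Taking an arbitrary syzygy divides the class by `t`. -/
theorem stableClass_of_exact {K P M : FGModuleCat.{u} R} [Module.Projective R P]
    {f : K →ₗ[R] P} {g : P →ₗ[R] M} (hf : Function.Injective f) (hfg : Function.Exact f g)
    (hg : Function.Surjective g) :
    stableClass hG hd M = (LaurentPolynomial.T 1 : ℤ[T;T⁻¹]) • stableClass hG hd K := by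
  have hR := (hG.extVanishesAbove_and_exists_isRegular hd).1
  have hP : Module.Free R P := Module.free_of_flat_of_isLocalRing
  obtain ⟨F, _, _, ι, π, hF, hfin, hι, hex, hπ, -⟩ := isMinimalSyzygy_syzygy M
  -- `K` and `Ω M` differ by free summands, so have the same syzygies
  obtain ⟨e⟩ := IsMinimalSyzygy.nonempty_equiv_of_exact hf hfg hg hι hex hπ
    (isMinimalSyzygy_syzygy K) (isMinimalSyzygy_syzygy (syzygy M))
  obtain ⟨e'⟩ := nonempty_syzygy_iterate_congr e d
  have h1 : syzygy^[d] (syzygy (syzygy M)) = syzygy (syzygy^[d + 1] M) := by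
    rw [← Function.iterate_succ_apply, ← Function.iterate_succ_apply,
      Function.iterate_succ_apply']
  have h2 := permMcmPart_syzygy hG hK hd (reducedAcyclic_syzygy_iterate hR M)
  have h3 : permMcmPart hG hd (syzygy^[d] (syzygy K)) =
      permMcmPart hG hd (syzygy (syzygy^[d + 1] M)) :=
    congrArg (toPermModule _) ((mcmPart_congr hK e').trans (by rw [h1]))
  rw [stableClass, stableClass, Function.iterate_succ_apply syzygy d K, h3, h2, smul_smul,
    smul_smul, ← LaurentPolynomial.T_add, ← LaurentPolynomial.T_add]
  congr 2
  ring

/-- Factoring out a projective submodule does not change the class: if `F → N` is a free cover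
with `N = M/P`, then `P × F → M` is surjective with kernel `Ω N`. -/
theorem stableClass_eq_of_exact {P M N : FGModuleCat.{u} R} [Module.Projective R P]
    {f : P →ₗ[R] M} {g : M →ₗ[R] N} (hf : Function.Injective f) (hfg : Function.Exact f g)
    (hg : Function.Surjective g) : stableClass hG hd M = stableClass hG hd N := by
  obtain ⟨n, π, hπ'⟩ := exists_isFreeCover (R := R) N
  have hπ := hπ'.surjective
  obtain ⟨a, ha⟩ := Module.projective_lifting_property g π hg
  have ha' : ∀ x, g (a x) = π x := LinearMap.congr_fun ha
  let q : (P × (Fin n → R)) →ₗ[R] M := f.coprod a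
  have hq : ∀ x, q x = f x.1 + a x.2 := fun x => rfl
  have hgf : ∀ p, g (f p) = 0 := fun p => (hfg _).2 ⟨p, rfl⟩
  have hqs : Function.Surjective q := by
    intro m
    obtain ⟨x, hx⟩ := hπ (g m)
    obtain ⟨p, hp⟩ := (hfg (m - a x)).1 (by rw [map_sub, ha', hx, sub_self])
    exact ⟨(p, x), by rw [hq, hp, sub_add_cancel]⟩
  have hmaps : ∀ y ∈ LinearMap.ker q, LinearMap.snd R P (Fin n → R) y ∈ LinearMap.ker π := by
    intro y hy
    have hy' : f y.1 + a y.2 = 0 := hy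
    have := congrArg g hy'
    rw [map_add, hgf, zero_add, ha', map_zero] at this
    exact this
  let s : LinearMap.ker q →ₗ[R] LinearMap.ker π := (LinearMap.snd R P (Fin n → R)).restrict hmaps
  have hs : Function.Bijective s := by
    constructor
    · rw [injective_iff_map_eq_zero]
      rintro ⟨⟨p, x⟩, hy⟩ h0
      have hx : x = 0 := congrArg Subtype.val h0
      subst hx
      have hp : f p + a 0 = 0 := hy
      rw [map_zero, add_zero] at hp
      exact Subtype.ext (Prod.ext (hf (hp.trans (map_zero f).symm)) rfl)
    · rintro ⟨x, hx⟩
      have hx' : π x = 0 := hx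
      obtain ⟨p, hp⟩ := (hfg (-(a x))).1 (by rw [map_neg, ha', hx', neg_zero])
      exact ⟨⟨(p, x), by change f p + a x = 0; rw [hp, neg_add_cancel]⟩, rfl⟩
  have h1 := stableClass_of_exact hG hK hd (K := FGModuleCat.of R (LinearMap.ker q))
    (P := FGModuleCat.of R (P × (Fin n → R))) (M := M) (f := (LinearMap.ker q).subtype) (g := q)
    (Submodule.injective_subtype _) (LinearMap.exact_subtype_ker_map q) hqs
  have h2 := stableClass_of_exact hG hK hd (K := FGModuleCat.of R (LinearMap.ker π))
    (P := FGModuleCat.of R (Fin n → R)) (M := N) (f := (LinearMap.ker π).subtype) (g := π)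
    (Submodule.injective_subtype _) (LinearMap.exact_subtype_ker_map π) hπ
  rw [h1, h2, stableClass_congr hG hK hd (M := FGModuleCat.of R (LinearMap.ker q))
    (N := FGModuleCat.of R (LinearMap.ker π)) (LinearEquiv.ofBijective s hs)]

omit hK in
/-- The `ℤ[t, t⁻¹]`-linear extension of `stableClass` to the free module on isomorphism
classes. -/
noncomputable def freeStableClass :
    FreeOnClasses R →ₗ[ℤ[T;T⁻¹]] PermModule (cosyzygyPerm hG hd) :=
  Finsupp.linearCombination _ fun x : IsoClass R => stableClass hG hd (Quotient.out x)

theorem freeStableClass_gen (M : FGModuleCat.{u} R) :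
    freeStableClass hG hd (gen M) = stableClass hG hd M := by
  rw [freeStableClass, gen, Finsupp.linearCombination_single, one_smul]
  obtain ⟨e⟩ := isoClass_eq_iff.1 (isoClass_out (isoClass M))
  exact stableClass_congr hG hK hd e

theorem relations_le_ker_freeStableClass :
    relations R ≤ LinearMap.ker (freeStableClass hG hd) := by
  rw [relations, Submodule.span_le]
  rintro z ((⟨P, M, M', f, g, hP, hf, hfg, hg, rfl⟩ | ⟨M', P, M, f, g, hP, hf, hfg, hg, rfl⟩) |
    ⟨M, M', rfl⟩)
  · rw [SetLike.mem_coe, LinearMap.mem_ker, map_sub, freeStableClass_gen hG hK,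
      freeStableClass_gen hG hK, stableClass_eq_of_exact hG hK hd hf hfg hg, sub_self]
  · rw [SetLike.mem_coe, LinearMap.mem_ker, map_sub, map_smul, freeStableClass_gen hG hK,
      freeStableClass_gen hG hK, stableClass_of_exact hG hK hd hf hfg hg, sub_self]
  · rw [SetLike.mem_coe, LinearMap.mem_ker, map_sub, map_sub, freeStableClass_gen hG hK,
      freeStableClass_gen hG hK, freeStableClass_gen hG hK, stableClass_prod hG hK]
    abel

omit hK in
/-- The inverse of the canonical map. -/
noncomputable def stableClassJ (hK : KrullRemakSchmidt R) :
    J R →ₗ[ℤ[T;T⁻¹]] PermModule (cosyzygyPerm hG hd) :=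
  (relations R).liftQ (freeStableClass hG hd) (relations_le_ker_freeStableClass hG hK hd)

theorem stableClassJ_classJ (M : FGModuleCat.{u} R) :
    stableClassJ hG hd hK (classJ (isoClass M)) = stableClass hG hd M :=
  freeStableClass_gen hG hK hd M

end StableClass

/-! ### Relations between classes in `J(R)` -/

section ClassJ

variable {R : Type u} [CommRing R]

theorem classJ_of_exact {K P M : FGModuleCat.{u} R} [Module.Projective R P]
    {f : K →ₗ[R] P} {g : P →ₗ[R] M} (hf : Function.Injective f) (hfg : Function.Exact f g)
    (hg : Function.Surjective g) :
    classJ (isoClass M) = (LaurentPolynomial.T 1 : ℤ[T;T⁻¹]) • classJ (isoClass K) := by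
  rw [← sub_eq_zero, classJ, classJ, ← map_smul, ← map_sub, Submodule.mkQ_apply,
    Submodule.Quotient.mk_eq_zero]
  exact Submodule.subset_span (Or.inl (Or.inr ⟨K, P, M, f, g, ‹_›, hf, hfg, hg, rfl⟩))

theorem classJ_prod (M N : FGModuleCat.{u} R) :
    classJ (isoClass (FGModuleCat.of R (M × N))) = classJ (isoClass M) + classJ (isoClass N) := by
  rw [← sub_eq_zero, ← sub_sub, classJ, classJ, classJ, ← map_sub, ← map_sub, Submodule.mkQ_apply,
    Submodule.Quotient.mk_eq_zero]
  exact Submodule.subset_span (Or.inr ⟨M, N, rfl⟩)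

theorem classJ_of_subsingleton (M : FGModuleCat.{u} R) [Subsingleton M] :
    classJ (isoClass M) = 0 := by
  have h := classJ_prod M M
  have : isoClass (FGModuleCat.of R (M × M)) = isoClass M :=
    isoClass_eq_iff.2 ⟨⟨0, 0, fun _ => Subsingleton.elim _ _, fun _ => Subsingleton.elim _ _⟩⟩
  rw [this] at h
  exact left_eq_add.1 h

theorem classJ_pi (n : ℕ) (N : Fin n → FGModuleCat.{u} R) (M : FGModuleCat.{u} R)
    (e : M ≃ₗ[R] (∀ i, N i)) : classJ (isoClass M) = ∑ i, classJ (isoClass (N i)) := by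
  induction n generalizing M with
  | zero =>
    have := e.toEquiv.subsingleton
    rw [classJ_of_subsingleton, Fin.sum_univ_zero]
  | succ n ih =>
    have h : isoClass M = isoClass (FGModuleCat.of R
        (N 0 × FGModuleCat.of R (∀ i : Fin n, N i.succ))) :=
      isoClass_eq_iff.2 ⟨e.trans (Fin.consLinearEquiv R fun i => N i).symm⟩
    rw [h, classJ_prod, Fin.sum_univ_succ,
      ih (fun i => N i.succ) (FGModuleCat.of R (∀ i : Fin n, N i.succ)) (LinearEquiv.refl R _)]

variable [IsLocalRing R]

theorem IsMinimalSyzygy.classJ_eq {K M : FGModuleCat.{u} R} (h : IsMinimalSyzygy R K M) :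
    classJ (isoClass M) = (LaurentPolynomial.T 1 : ℤ[T;T⁻¹]) • classJ (isoClass K) := by
  obtain ⟨F, _, _, ι, π, hF, hfin, hι, hex, hπ, -⟩ := h
  exact classJ_of_exact (P := FGModuleCat.of R F) hι hex hπ

variable [IsNoetherianRing R]

theorem classJ_syzygy_iterate (M : FGModuleCat.{u} R) (n : ℕ) :
    classJ (isoClass M) =
      (LaurentPolynomial.T n : ℤ[T;T⁻¹]) • classJ (isoClass (syzygy^[n] M)) := by
  induction n with
  | zero => simp
  | succ n ih =>
    rw [ih, Function.iterate_succ_apply', (isMinimalSyzygy_syzygy (syzygy^[n] M)).classJ_eq,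
      smul_smul, ← LaurentPolynomial.T_add, Nat.cast_succ]

omit [IsNoetherianRing R] in
theorem canonicalMap_single (x : mcmClasses R) (k : ℤ) :
    canonicalMap R (Finsupp.single x k) = k • classJ x.1 :=
  Finsupp.linearCombination_single _ _ _

theorem canonicalMap_mcmPart (hG : IsGorenstein R) (hK : KrullRemakSchmidt R) {d : ℕ}
    (hd : ringKrullDim R = d) {M : FGModuleCat.{u} R} (hM : ReducedAcyclic R M) :
    canonicalMap R (mcmPart M) = classJ (isoClass M) := by
  obtain ⟨n, N, hN, ⟨e⟩⟩ := exists_indecomposable_decomposition M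
  rw [mcmPart_eq_sum_single hG hK hd hM hN e, map_sum, classJ_pi n N M e]
  exact Finset.sum_congr rfl fun i _ => by rw [canonicalMap_single, one_smul]

theorem classJ_cosyzygyPerm (hG : IsGorenstein R) {d : ℕ} (hd : ringKrullDim R = d)
    (x : mcmClasses R) :
    classJ (cosyzygyPerm hG hd x).1 = (LaurentPolynomial.T 1 : ℤ[T;T⁻¹]) • classJ x.1 := by
  have hR := (hG.extVanishesAbove_and_exists_isRegular hd).1
  have hx := (isoClass_mem_mcmClasses_iff hG hd (M := (Quotient.out x.1 : FGModuleCat.{u} R))).1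
    (by rw [isoClass_out]; exact x.2)
  have h := (hx.2.isMinimalSyzygy_cosyzygy hR).classJ_eq
  rwa [isoClass_cosyzygy_eq hG hd x _ (isoClass_out x.1), isoClass_out] at h

theorem classJ_cosyzygyPerm_zpow (hG : IsGorenstein R) {d : ℕ} (hd : ringKrullDim R = d)
    (n : ℤ) (x : mcmClasses R) :
    classJ ((cosyzygyPerm hG hd ^ n) x).1 =
      (LaurentPolynomial.T n : ℤ[T;T⁻¹]) • classJ x.1 := by
  induction n generalizing x with
  | zero => simp
  | succ n ih =>
    rw [zpow_add_one, Equiv.Perm.mul_apply, ih, classJ_cosyzygyPerm, smul_smul,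
      ← LaurentPolynomial.T_add]
  | pred n ih =>
    have h := classJ_cosyzygyPerm hG hd ((cosyzygyPerm hG hd)⁻¹ x)
    rw [show cosyzygyPerm hG hd ((cosyzygyPerm hG hd)⁻¹ x) = x from
      Equiv.apply_symm_apply _ x] at h
    rw [zpow_sub_one, Equiv.Perm.mul_apply, ih, h, smul_smul, ← LaurentPolynomial.T_add]
    simp

/-- The canonical map is `ℤ[t, t⁻¹]`-linear. -/
theorem canonicalMap_smul (hG : IsGorenstein R) {d : ℕ} (hd : ringKrullDim R = d)
    (p : ℤ[T;T⁻¹]) (v : PermModule (cosyzygyPerm hG hd)) :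
    canonicalMap R ((toPermModule _).symm (p • v)) =
      p • canonicalMap R ((toPermModule _).symm v) := by
  obtain ⟨v, rfl⟩ := (toPermModule _).surjective v
  rw [AddEquiv.symm_apply_apply]
  induction p using LaurentPolynomial.induction_on' with
  | add p q hp hq => rw [add_smul, map_add, map_add, hp, hq, add_smul]
  | C_mul_T n a =>
    have ha : (LaurentPolynomial.C a : ℤ[T;T⁻¹]) = ((a : ℤ) : ℤ[T;T⁻¹]) := by simp
    rw [ha, mul_smul, mul_smul, Int.cast_smul_eq_zsmul, Int.cast_smul_eq_zsmul, map_zsmul,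
      map_zsmul]
    congr 1
    induction v using Finsupp.induction_linear with
    | zero => simp
    | add f g hf hg => rw [map_add, smul_add, map_add, map_add, hf, hg, map_add, smul_add]
    | single x k =>
      rw [T_smul_single, AddEquiv.symm_apply_apply, canonicalMap_single, canonicalMap_single,
        classJ_cosyzygyPerm_zpow, smul_comm]

/-- The canonical map as an isomorphism of `ℤ[t, t⁻¹]`-modules. -/
noncomputable def canonicalEquiv (hG : IsGorenstein R) (hK : KrullRemakSchmidt R) {d : ℕ}
    (hd : ringKrullDim R = d) : PermModule (cosyzygyPerm hG hd) ≃ₗ[ℤ[T;T⁻¹]] J R :=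
  have hR := (hG.extVanishesAbove_and_exists_isRegular hd).1
  let Φ : PermModule (cosyzygyPerm hG hd) →ₗ[ℤ[T;T⁻¹]] J R :=
    { toFun := fun v => canonicalMap R ((toPermModule _).symm v)
      map_add' := fun v w => by rw [map_add, map_add]
      map_smul' := canonicalMap_smul hG hd }
  have hΦ : ∀ a, Φ (toPermModule _ a) = canonicalMap R a := fun a => rfl
  LinearEquiv.ofLinearMap Φ (stableClassJ hG hd hK)
    (by
      refine Submodule.linearMap_qext _ (Finsupp.lhom_ext' fun x => LinearMap.ext_ring ?_)
      obtain ⟨M, rfl⟩ : ∃ M, isoClass M = x := ⟨_, isoClass_out x⟩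
      change Φ (stableClassJ hG hd hK (classJ (isoClass M))) = classJ (isoClass M)
      rw [stableClassJ_classJ, stableClass, map_smul, permMcmPart, hΦ,
        canonicalMap_mcmPart hG hK hd (reducedAcyclic_syzygy_iterate hR M),
        ← classJ_syzygy_iterate])
    (by
      refine LinearMap.ext fun v => ?_
      obtain ⟨v, rfl⟩ := (toPermModule _).surjective v
      change stableClassJ hG hd hK (canonicalMap R v) = toPermModule _ v
      induction v using Finsupp.induction_linear with
      | zero => simp
      | add f g hf hg => rw [map_add, map_add, map_add, hf, hg]
      | single x k =>
        have hx := (isoClass_mem_mcmClasses_iff hG hd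
          (M := (Quotient.out x.1 : FGModuleCat.{u} R))).1 (by rw [isoClass_out]; exact x.2)
        have h1 : mcmPart (Quotient.out x.1 : FGModuleCat.{u} R) = Finsupp.single x 1 := by
          rw [mcmPart_eq hK (I := Unit) (N := fun _ => Quotient.out x.1) (fun _ => hx.1)
            (LinearEquiv.funUnique Unit R _).symm, Fintype.sum_unique,
            mcmIndicator_of_mem (by rw [isoClass_out]; exact x.2)]
          congr 1
          exact Subtype.ext (isoClass_out x.1)
        have h2 := stableClassJ_classJ hG hK hd (Quotient.out x.1)
        rw [isoClass_out, stableClass_of_reducedAcyclic hG hK hd hx.2, permMcmPart, h1] at h2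
        rw [canonicalMap_single, map_zsmul, h2, ← map_zsmul, Finsupp.smul_single, smul_eq_mul,
          mul_one])

end ClassJ

end GrothMod

theorem theorem4p1 (R : Type u) [CommRing R] [IsLocalRing R] [IsNoetherianRing R]
    (hGor : IsGorenstein R) (hKRS : KrullRemakSchmidt R)
    (d : ℕ) (hd : ringKrullDim R = d) :
    ∃ σ : Equiv.Perm (mcmClasses R),
      -- `t` acts by the cosyzygy, `t⁻¹` by the syzygy
      (∀ (x : mcmClasses R) (M : FGModuleCat.{u} R), isoClass M = x.1 →
        isoClass (cosyzygy M) = (σ x).1 ∧ isoClass (syzygy M) = (σ.symm x).1) ∧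
      -- the canonical map is an isomorphism of `ℤ[t, t⁻¹]`-modules
      ∃ Φ : PermModule σ ≃ₗ[ℤ[T;T⁻¹]] J R,
        (∀ a : mcmClasses R →₀ ℤ, Φ (toPermModule σ a) = canonicalMap R a) ∧
        -- the inverse
        ∀ M : FGModuleCat.{u} R,
          (∃ (n : ℕ) (N : Fin n → FGModuleCat.{u} R), (∀ i, IsIndecomposable R (N i)) ∧
            Nonempty (cosyzygy^[d + 1] (syzygy^[d + 1] M) ≃ₗ[R] (∀ i, N i))) ∧
          ∀ (n : ℕ) (N : Fin n → FGModuleCat.{u} R), (∀ i, IsIndecomposable R (N i)) →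
            Nonempty (cosyzygy^[d + 1] (syzygy^[d + 1] M) ≃ₗ[R] (∀ i, N i)) →
            ∃ hN : ∀ i, isoClass (N i) ∈ mcmClasses R,
              Φ.symm (classJ (isoClass M)) =
                toPermModule σ (∑ i, Finsupp.single ⟨isoClass (N i), hN i⟩ 1) := by
  have hR := (hGor.extVanishesAbove_and_exists_isRegular hd).1
  refine ⟨cosyzygyPerm hGor hd, fun x M h => ⟨isoClass_cosyzygy_eq hGor hd x M h,
    isoClass_syzygy_eq hGor hd x M h⟩, canonicalEquiv hGor hKRS hd, fun a => rfl,
    fun M => ⟨exists_indecomposable_decomposition _, ?_⟩⟩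
  rintro n N hN ⟨e⟩
  have hK := reducedAcyclic_syzygy_iterate hR M
  have hL := hK.cosyzygy_iterate hR (d + 1)
  refine ⟨mem_mcmClasses_of_decomposition hGor hd hL hN e, ?_⟩
  rw [← mcmPart_eq_sum_single hGor hKRS hd hL hN e]
  change stableClassJ hGor hd hKRS (classJ (isoClass M)) = _
  rw [stableClassJ_classJ]
  exact (permMcmPart_cosyzygy_iterate hGor hKRS hd hK (d + 1)).symm
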